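/- Let $(M^{2n},g,J)$ be a connected strict nearly Kähler manifold: $g=\langle\cdot,\cdot\rangle$ is a smooth Riemannian metric on the smooth connected manifold $M$, $J$ is a smooth orthogonal almost complex structure, and, with $\nabla$ the Levi-Civita connection of $g$, $(\nabla_XJ)X=0$ for every tangent vector $X$, and $\nabla_XJ\neq 0$ for every tangent vector $X\neq 0$. Let $R$ be the curvature tensor of $g$, with the sign for which $R(X,Y,X,Y)$ is the sectional curvature of an orthonormal pair $X,Y$. For a local orthonormal frame $(e_k)$ put $$Ric(X,Y)=\sum_k R(X,e_k,Y,e_k),\qquad Ric^{\star}(X,Y)=\tfrac12\sum_k R(X,JY,e_k,Je_k),$$ and let $r:TM\to TM$ be the tensor defined by $\langle rX,Y\rangle=\sum_k\langle(\nabla_{e_k}J)X,(\nabla_{e_k}J)Y\rangle$. Then $\langle rX,Y\rangle=Ric(X,Y)-Ric^{\star}(X,Y)$ for all $X,Y$, and there are pairwise distinct real numbers $\lambda_1,\dots,\lambda_p>0$ that are the eigenvalues of $r$ at every point of $M$, so that $TM=\bigoplus_{i=1}^pE_i$, where $E_i$ is the eigenbundle of $r$ for the eigenvalue $\lambda_i$.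 With respect to this decomposition: (i) $Ric(X,Y)=0$ if $X$ belongs to $E_i$, $Y$ belongs to $E_j$ and $i\neq j$. (ii) If $X,Y$ belong to $E_i$, then $$Ric(X,Y)=\frac{\lambda_i}{4}\langle X,Y\rangle+\frac1{\lambda_i}\sum_{s=1}^p\lambda_s\langle r^s(X),Y\rangle,$$ where the tensors $r^s:TM\to TM$, $1\le s\le p$, are defined by $\langle r^s(X),Y\rangle=-\mathrm{Tr}_{E_s}\big((\nabla_XJ)(\nabla_YJ)\big)$ for all $X,Y$ in $TM$, and $\mathrm{Tr}_{W}(A)=\sum_k\langle Aw_k,w_k\rangle$ for an orthonormal basis $(w_k)$ of $W$. -/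

import Mathlib

open Bundle Manifold FiberBundle VectorField
open scoped ContDiff

namespace NearlyKahler

noncomputable section

section LinearAlgebra

variable {V : Type*} [NormedAddCommGroup V] [InnerProductSpace ℝ V] [FiniteDimensional ℝ V]

/-- The endomorphism `S` with `⟪S u, w⟫ = B u w`. -/
def ofForm (B : V →L[ℝ] V →L[ℝ] ℝ) : V →L[ℝ] V :=
  LinearMap.toContinuousLinearMap
    { toFun := fun u => (InnerProductSpace.toDual ℝ V).symm (B u)
      map_add' := by simp
      map_smul' := by simp }

theorem inner_ofForm (B : V →L[ℝ] V →L[ℝ] ℝ) (u w : V) :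
    inner ℝ (ofForm B u) w = B u w := by
  simp [ofForm]

/-- The trace of the endomorphism `A` over the subspace `W`, i.e. `∑ₖ ⟪A eₖ, eₖ⟫` where `(eₖ)` is
an orthonormal basis of `W`. -/
def traceOn (W : Submodule ℝ V) (A : V →L[ℝ] V) : ℝ :=
  ∑ k, inner ℝ (A (stdOrthonormalBasis ℝ W k)) (stdOrthonormalBasis ℝ W k : V)

end LinearAlgebra

variable {E : Type*} [NormedAddCommGroup E] [NormedSpace ℝ E]
  {H : Type*} [TopologicalSpace H] (I : ModelWithCorners ℝ E H)
  {M : Type*} [TopologicalSpace M] [ChartedSpace H M]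

instance [FiniteDimensional ℝ E] (x : M) : FiniteDimensional ℝ (TangentSpace I x) :=
  inferInstanceAs (FiniteDimensional ℝ E)

section LeviCivita

variable [RiemannianBundle (fun x : M => TangentSpace I x)]

/-- Half of the right-hand side of the Koszul formula for `⟪∇_X Y, Z⟫`. -/
def koszul (X Y Z : Π x : M, TangentSpace I x) (x : M) : ℝ :=
  (1 / 2 : ℝ) *
    (d% (fun y => inner ℝ (Y y) (Z y)) x (X x)
      + d% (fun y => inner ℝ (Z y) (X y)) x (Y x)
      - d% (fun y => inner ℝ (X y) (Y y)) x (Z x)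
      + inner ℝ (mlieBracket I X Y x) (Z x)
      - inner ℝ (mlieBracket I Y Z x) (X x)
      + inner ℝ (mlieBracket I Z X x) (Y x))

variable [FiniteDimensional ℝ E] [IsManifold I ∞ M]
  [IsContMDiffRiemannianBundle I ∞ E (fun x : M => TangentSpace I x)]

theorem mdifferentiableAt_inner {X Y : Π x : M, TangentSpace I x} {x : M}
    (hX : MDiffAt (T% X) x) (hY : MDiffAt (T% Y) x) :
    MDiffAt (fun y => inner ℝ (X y) (Y y)) x :=
  MDifferentiableAt.inner_bundle (IB := I) (F := E) (E := fun y : M => TangentSpace I y)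
    (b := fun y => y) hX hY

theorem koszul_tensorial_left {Y Z : Π x : M, TangentSpace I x} {x : M}
    (hY : MDiffAt (T% Y) x) (hZ : MDiffAt (T% Z) x) :
    TensorialAt I E (fun X => koszul I X Y Z x) x where
  smul {f X} hf hX := by
    have h1 := mvfderiv_fun_mul hf (mdifferentiableAt_inner I hZ hX)
    have h2 := mvfderiv_fun_mul hf (mdifferentiableAt_inner I hX hY)
    simp only [koszul, Pi.smul_apply', inner_smul_left, inner_smul_right, map_smul,
      RCLike.conj_to_real]
    rw [h1, h2, mlieBracket_smul_left hf hX, mlieBracket_smul_right hf hX]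
    simp [inner_add_left, inner_smul_left, real_inner_comm]
    ring
  add {X X'} hX hX' := by
    have h1 := mvfderiv_fun_add (mdifferentiableAt_inner I hZ hX) (mdifferentiableAt_inner I hZ hX')
    have h2 := mvfderiv_fun_add (mdifferentiableAt_inner I hX hY) (mdifferentiableAt_inner I hX' hY)
    simp only [koszul, Pi.add_apply, inner_add_left, inner_add_right, map_add]
    rw [h1, h2, mlieBracket_add_left hX hX', mlieBracket_add_right hX hX']
    simp [inner_add_left]
    ring

theorem koszul_tensorial_right {X Y : Π x : M, TangentSpace I x} {x : M}
    (hX : MDiffAt (T% X) x) (hY : MDiffAt (T% Y) x) :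
    TensorialAt I E (fun Z => koszul I X Y Z x) x where
  smul {f Z} hf hZ := by
    have h1 := mvfderiv_fun_mul hf (mdifferentiableAt_inner I hY hZ)
    have h2 := mvfderiv_fun_mul hf (mdifferentiableAt_inner I hZ hX)
    simp only [koszul, Pi.smul_apply', inner_smul_left, inner_smul_right, map_smul,
      RCLike.conj_to_real]
    rw [h1, h2, mlieBracket_smul_left hf hZ, mlieBracket_smul_right hf hZ]
    simp [inner_add_left, inner_smul_left, real_inner_comm]
    ring
  add {Z Z'} hZ hZ' := by
    have h1 := mvfderiv_fun_add (mdifferentiableAt_inner I hY hZ) (mdifferentiableAt_inner I hY hZ')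
    have h2 := mvfderiv_fun_add (mdifferentiableAt_inner I hZ hX) (mdifferentiableAt_inner I hZ' hX)
    simp only [koszul, Pi.add_apply, inner_add_left, inner_add_right, map_add]
    rw [h1, h2, mlieBracket_add_left hZ hZ', mlieBracket_add_right hZ hZ']
    simp [inner_add_left]
    ring

open Classical in
/-- The Levi-Civita connection on vector fields, through the Koszul formula: `leviCivitaFun I Y x v`
is `∇_v Y`, for `Y` differentiable at `x` (and a junk value otherwise). -/
def leviCivitaFun (Y : Π x : M, TangentSpace I x) (x : M) :
    TangentSpace I x →L[ℝ] TangentSpace I x :=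
  if hY : MDiffAt (T% Y) x then
    ofForm (TensorialAt.mkHom₂ (I := I) (F := E) (F' := E) (fun X Z => koszul I X Y Z x) x
      (fun _ hZ => koszul_tensorial_left I hY hZ)
      (fun _ hX => koszul_tensorial_right I hX hY))
  else 0

theorem inner_leviCivitaFun {X Y Z : Π x : M, TangentSpace I x} {x : M}
    (hX : MDiffAt (T% X) x) (hY : MDiffAt (T% Y) x) (hZ : MDiffAt (T% Z) x) :
    inner ℝ (leviCivitaFun I Y x (X x)) (Z x) = koszul I X Y Z x := by
  rw [leviCivitaFun, dif_pos hY, inner_ofForm]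
  exact TensorialAt.mkHom₂_apply _ _ hX hZ

theorem isCovariantDerivativeOn_leviCivitaFun :
    IsCovariantDerivativeOn E (leviCivitaFun I (M := M)) Set.univ where
  add {Y Y' x} hY hY' _ := by
    ext v
    refine ext_inner_right ℝ fun w => ?_
    have hX := mdifferentiableAt_extend I E v
    have hZ := mdifferentiableAt_extend I E w
    have h1 := mvfderiv_fun_add (mdifferentiableAt_inner I hY hZ) (mdifferentiableAt_inner I hY' hZ)
    have h2 := mvfderiv_fun_add (mdifferentiableAt_inner I hX hY) (mdifferentiableAt_inner I hX hY')
    have e := inner_leviCivitaFun I hX (mdifferentiableAt_add_section hY hY') hZ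
    have e1 := inner_leviCivitaFun I hX hY hZ
    have e2 := inner_leviCivitaFun I hX hY' hZ
    simp only [extend_apply_self] at e e1 e2
    rw [e, add_apply, inner_add_left, e1, e2]
    simp only [koszul, Pi.add_apply, inner_add_left, inner_add_right, map_add]
    rw [h1, h2, mlieBracket_add_left hY hY', mlieBracket_add_right hY hY']
    simp [inner_add_left]
    ring
  leibniz {Y f x} hY hf _ := by
    ext v
    refine ext_inner_right ℝ fun w => ?_
    have hX := mdifferentiableAt_extend I E v
    have hZ := mdifferentiableAt_extend I E w
    have h1 := mvfderiv_fun_mul hf (mdifferentiableAt_inner I hY hZ)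
    have h2 := mvfderiv_fun_mul hf (mdifferentiableAt_inner I hX hY)
    have e := inner_leviCivitaFun I hX (hf.smul_section hY) hZ
    have e1 := inner_leviCivitaFun I hX hY hZ
    simp only [extend_apply_self] at e e1
    rw [e, add_apply, inner_add_left, smul_apply,
      inner_smul_left, e1]
    simp only [koszul, Pi.smul_apply', inner_smul_left, inner_smul_right, map_smul,
      RCLike.conj_to_real]
    rw [h1, h2, mlieBracket_smul_left hf hY, mlieBracket_smul_right hf hY]
    simp [inner_add_left, inner_smul_left, real_inner_comm]
    ring

variable (M) in
/-- The Levi-Civita connection of the Riemannian manifold `M`; `leviCivita I M Y x v` is `∇_v Y`. -/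
def leviCivita : CovariantDerivative I E (fun x : M => TangentSpace I x) where
  toFun := leviCivitaFun I
  isCovariantDerivativeOnUniv := isCovariantDerivativeOn_leviCivitaFun I

theorem inner_leviCivita {X Y Z : Π x : M, TangentSpace I x} {x : M}
    (hX : MDiffAt (T% X) x) (hY : MDiffAt (T% Y) x) (hZ : MDiffAt (T% Z) x) :
    inner ℝ (leviCivita I M Y x (X x)) (Z x) = koszul I X Y Z x :=
  inner_leviCivitaFun I hX hY hZ

theorem leviCivita_torsion : (leviCivita I M).torsion = 0 := by
  rw [CovariantDerivative.torsion_eq_zero_iff]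
  intro X Y x hX hY
  refine ext_inner_right ℝ fun w => ?_
  have hZ := mdifferentiableAt_extend I E w
  have e1 := inner_leviCivita I hX hY hZ
  have e2 := inner_leviCivita I hY hX hZ
  simp only [extend_apply_self] at e1 e2
  rw [inner_sub_left, e1, e2]
  simp only [koszul]
  rw [mlieBracket_swap_apply (V := Y) (W := X), mlieBracket_swap_apply (V := extend E w) (W := Y),
    mlieBracket_swap_apply (V := extend E w) (W := X)]
  simp [real_inner_comm, inner_neg_left]
  ring

theorem leviCivita_metric {X Y Z : Π x : M, TangentSpace I x} {x : M}
    (hX : MDiffAt (T% X) x) (hY : MDiffAt (T% Y) x) (hZ : MDiffAt (T% Z) x) :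
    d% (fun y => inner ℝ (Y y) (Z y)) x (X x) =
      inner ℝ (leviCivita I M Y x (X x)) (Z x) + inner ℝ (Y x) (leviCivita I M Z x (X x)) := by
  rw [real_inner_comm (leviCivita I M Z x (X x)), inner_leviCivita I hX hY hZ,
    inner_leviCivita I hX hZ hY]
  simp only [koszul]
  rw [mlieBracket_swap_apply (V := Z) (W := Y), mlieBracket_swap_apply (V := Y) (W := X),
    mlieBracket_swap_apply (V := Z) (W := X)]
  simp [real_inner_comm, inner_neg_left]
  ring

/-- The vector field `R(X, Y)Z = ∇_X ∇_Y Z - ∇_Y ∇_X Z - ∇_[X,Y] Z`. -/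
def curvatureField (X Y Z : Π x : M, TangentSpace I x) (x : M) : TangentSpace I x :=
  leviCivita I M (fun y => leviCivita I M Z y (Y y)) x (X x)
    - leviCivita I M (fun y => leviCivita I M Z y (X y)) x (Y x)
    - leviCivita I M Z x (mlieBracket I X Y x)

/-- The curvature tensor `R(a, b, c, d) = -⟪R(a, b)c, d⟫`, with the sign for which `R(a, b, a, b)` is
the sectional curvature of an orthonormal pair. As `R` is a tensor, its value on tangent vectors at
`x` is computed on vector fields that extend them and are smooth near `x`. -/
def curvature (x : M) (a b c d : TangentSpace I x) : ℝ :=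
  -inner ℝ (curvatureField I (extend E a) (extend E b) (extend E c) x) d

/-- The Ricci tensor `Ric(u, v) = ∑ₖ R(u, eₖ, v, eₖ)`, for an orthonormal basis `(eₖ)`. -/
def ricci (x : M) (u v : TangentSpace I x) : ℝ :=
  ∑ k, curvature I x u (stdOrthonormalBasis ℝ (TangentSpace I x) k) v
    (stdOrthonormalBasis ℝ (TangentSpace I x) k)

end LeviCivita

/-- An almost Hermitian structure on the Riemannian manifold `M`: a smooth orthogonal almost complex
structure. -/
structure AlmostHermitian (M : Type*) [TopologicalSpace M] [ChartedSpace H M] [IsManifold I ∞ M]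
    [RiemannianBundle (fun x : M => TangentSpace I x)] where
  J : Π x : M, TangentSpace I x →L[ℝ] TangentSpace I x
  contMDiff : ContMDiff I (I.prod 𝓘(ℝ, E →L[ℝ] E)) ∞
    (fun x : M => TotalSpace.mk' (E →L[ℝ] E)
      (E := fun y : M => TangentSpace I y →L[ℝ] TangentSpace I y) x (J x))
  sq : ∀ (x : M) (v : TangentSpace I x), J x (J x v) = -v
  inner_map : ∀ (x : M) (u v : TangentSpace I x), inner ℝ (J x u) (J x v) = inner ℝ u v

namespace AlmostHermitian

variable {I} [FiniteDimensional ℝ E] [IsManifold I ∞ M]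
  [RiemannianBundle (fun x : M => TangentSpace I x)]
  [IsContMDiffRiemannianBundle I ∞ E (fun x : M => TangentSpace I x)]
  (𝒥 : AlmostHermitian I M)

theorem mdifferentiableAt_apply {Y : Π x : M, TangentSpace I x} {x : M} (hY : MDiffAt (T% Y) x) :
    MDiffAt (T% (fun y => 𝒥.J y (Y y))) x :=
  MDifferentiableAt.clm_bundle_apply (F₁ := E) (E₁ := fun y : M => TangentSpace I y)
    (F₂ := E) (E₂ := fun y : M => TangentSpace I y) (b := fun y => y)
    (𝒥.contMDiff.mdifferentiable (by simp) x) hY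

theorem tensorial_nablaJ (x : M) :
    TensorialAt I E (fun Y : Π x : M, TangentSpace I x =>
      leviCivita I M (fun y => 𝒥.J y (Y y)) x - (𝒥.J x).comp (leviCivita I M Y x)) x where
  smul {f Y} hf hY := by
    have h := (leviCivita I M).isCovariantDerivativeOnUniv.leibniz
      (𝒥.mdifferentiableAt_apply hY) hf
    have h' := (leviCivita I M).isCovariantDerivativeOnUniv.leibniz hY hf
    have e : (fun y => 𝒥.J y ((f • Y) y)) = f • fun y => 𝒥.J y (Y y) := by
      ext y; simp
    rw [e, h, h']
    ext v
    simp [smul_sub]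
  add {Y Y'} hY hY' := by
    have h := (leviCivita I M).isCovariantDerivativeOnUniv.add
      (𝒥.mdifferentiableAt_apply hY) (𝒥.mdifferentiableAt_apply hY')
    have h' := (leviCivita I M).isCovariantDerivativeOnUniv.add hY hY'
    have e : (fun y => 𝒥.J y ((Y + Y') y)) =
        (fun y => 𝒥.J y (Y y)) + fun y => 𝒥.J y (Y' y) := by
      ext y; simp
    rw [e, h, h']
    ext v
    simp
    abel

/-- The tensor `∇J`: `𝒥.nablaJ x u v` is `(∇_u J) v = ∇_u (J V) - J (∇_u V)`, where the vector field
`V` extends `v`. -/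
def nablaJ (x : M) : TangentSpace I x →L[ℝ] TangentSpace I x →L[ℝ] TangentSpace I x :=
  (TensorialAt.mkHom (I := I) (F := E) (fun Y : Π x : M, TangentSpace I x =>
    leviCivita I M (fun y => 𝒥.J y (Y y)) x - (𝒥.J x).comp (leviCivita I M Y x)) x
    (𝒥.tensorial_nablaJ x)).flip

theorem nablaJ_apply {Y : Π x : M, TangentSpace I x} {x : M} (hY : MDiffAt (T% Y) x)
    (u : TangentSpace I x) :
    𝒥.nablaJ x u (Y x) =
      leviCivita I M (fun y => 𝒥.J y (Y y)) x u - 𝒥.J x (leviCivita I M Y x u) := by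
  have h := TensorialAt.mkHom_apply (𝒥.tensorial_nablaJ x) hY
  exact congr($h u)

/-- `(M, g, J)` is nearly Kähler: `(∇_X J) X = 0` for all `X`. -/
def IsNearlyKahler : Prop :=
  ∀ (x : M) (u : TangentSpace I x), 𝒥.nablaJ x u u = 0

/-- Strictness: `∇_X J ≠ 0` for every tangent vector `X ≠ 0`. -/
def IsStrict : Prop :=
  ∀ (x : M) (u : TangentSpace I x), u ≠ 0 → 𝒥.nablaJ x u ≠ 0

/-- The star-Ricci tensor `Ric*(u, v) = 1/2 ∑ₖ R(u, Jv, eₖ, Jeₖ)`, for an orthonormal basis `(eₖ)`. -/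
def starRicci (x : M) (u v : TangentSpace I x) : ℝ :=
  (1 / 2 : ℝ) * ∑ k, curvature I x u (𝒥.J x v) (stdOrthonormalBasis ℝ (TangentSpace I x) k)
    (𝒥.J x (stdOrthonormalBasis ℝ (TangentSpace I x) k))

/-- The tensor `r` with `⟪r u, v⟫ = ∑ₖ ⟪(∇_{eₖ} J) u, (∇_{eₖ} J) v⟫`, for an orthonormal basis
`(eₖ)`. -/
def r (x : M) : TangentSpace I x →L[ℝ] TangentSpace I x :=
  ofForm (∑ k, (innerSL ℝ).bilinearComp
    (𝒥.nablaJ x (stdOrthonormalBasis ℝ (TangentSpace I x) k))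
    (𝒥.nablaJ x (stdOrthonormalBasis ℝ (TangentSpace I x) k)))

theorem inner_r (x : M) (u v : TangentSpace I x) :
    inner ℝ (𝒥.r x u) v =
      ∑ k, inner ℝ (𝒥.nablaJ x (stdOrthonormalBasis ℝ (TangentSpace I x) k) u)
        (𝒥.nablaJ x (stdOrthonormalBasis ℝ (TangentSpace I x) k) v) := by
  simp [r, inner_ofForm]

/-- The eigenspace at `x` of `r` for the real number `c`; for an eigenvalue `c` of `r` these are the
fibres of the corresponding eigenbundle. -/
def eigenspace (x : M) (c : ℝ) : Submodule ℝ (TangentSpace I x) :=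
  Module.End.eigenspace (𝒥.r x : TangentSpace I x →ₗ[ℝ] TangentSpace I x) c

/-- The endomorphism `S` of the tangent space at `x` with
`⟪S u, v⟫ = -Tr_W ((∇_u J) (∇_v J))`. -/
def rPart (x : M) (W : Submodule ℝ (TangentSpace I x)) :
    TangentSpace I x →L[ℝ] TangentSpace I x :=
  ofForm (LinearMap.toContinuousBilinearMap (LinearMap.mk₂ ℝ
    (fun u v => -traceOn W ((𝒥.nablaJ x u).comp (𝒥.nablaJ x v)))
    (by intro u u' v; simp [traceOn, inner_add_left, Finset.sum_add_distrib]; ring)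
    (by intro c u v; simp [traceOn, inner_smul_left, Finset.mul_sum])
    (by intro u v v'; simp [traceOn, inner_add_left, Finset.sum_add_distrib]; ring)
    (by intro c u v; simp [traceOn, inner_smul_left, Finset.mul_sum])))

theorem inner_rPart (x : M) (W : Submodule ℝ (TangentSpace I x)) (u v : TangentSpace I x) :
    inner ℝ (𝒥.rPart x W u) v = -traceOn W ((𝒥.nablaJ x u).comp (𝒥.nablaJ x v)) := by
  simp [rPart, inner_ofForm]

end AlmostHermitian

end

end NearlyKahler

/-!
The canonical Hermitian connection `∇̄ = ∇ - ½ J ∇J` of a nearly Kähler manifold has parallel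
torsion: in the first Bianchi identity of `∇`, the terms quadratic in `∇J` have a different type
with respect to `J` than `∇̄∇J`, which forces `∇̄∇J = 0`. The curvature of `∇̄` therefore acts on
`∇J` as a derivation. Tracing this identity twice gives
`R̄ic(X, r Y) = ∑ ⟨(∇_X J) eᵢ, (∇_Y J) (r eᵢ)⟩`, whose right-hand side is symmetric in `X` and
`Y`, and `Ric = R̄ic + ¼ ⟨r ·, ·⟩`; evaluating on eigenvectors of `r` gives (i) and (ii).

Since `⟨r X, Y⟩ = -Tr ((∇_X J) (∇_Y J))`, the tensor `r` is `∇̄`-parallel as well. Hence the trace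
of every polynomial in `r` is constant, and these traces determine the eigenvalues of `r`.
-/

/-! ### Connections and curvature on vector fields -/

namespace NearlyKahler

/-- The algebra of vector fields of a Riemannian manifold: `𝔛` stands for the space of vector
fields, `C` for the space of functions, `deriv X f` for the derivative of `f` along `X`, and `nabla`
for the Levi-Civita connection. Only the `ℝ`-linear structure is recorded: the identities between
curvature tensors depend on nothing else. -/
structure RiemannianCalculus (𝔛 C : Type*) [AddCommGroup 𝔛] [Module ℝ 𝔛]
    [AddCommGroup C] [Module ℝ C] where
  deriv : 𝔛 → C →ₗ[ℝ] C
  bracket : 𝔛 → 𝔛 → 𝔛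
  metric : 𝔛 →ₗ[ℝ] 𝔛 →ₗ[ℝ] C
  nabla : 𝔛 →ₗ[ℝ] 𝔛 →ₗ[ℝ] 𝔛
  deriv_bracket : ∀ X Y f, deriv (bracket X Y) f = deriv X (deriv Y f) - deriv Y (deriv X f)
  jacobi : ∀ X Y Z,
    bracket X (bracket Y Z) = bracket (bracket X Y) Z + bracket Y (bracket X Z)
  metric_comm : ∀ X Y, metric X Y = metric Y X
  ext_metric : ∀ {X Y}, (∀ Z, metric X Z = metric Y Z) → X = Y
  deriv_metric : ∀ X Y Z, deriv X (metric Y Z) = metric (nabla X Y) Z + metric Y (nabla X Z)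
  torsion_free : ∀ X Y, nabla X Y - nabla Y X = bracket X Y

namespace RiemannianCalculus

variable {𝔛 C : Type*} [AddCommGroup 𝔛] [Module ℝ 𝔛] [AddCommGroup C] [Module ℝ C]
  (K : RiemannianCalculus 𝔛 C)

/-- The curvature operator of a connection `D`. -/
def curvatureOp (D : 𝔛 →ₗ[ℝ] 𝔛 →ₗ[ℝ] 𝔛) (X Y Z : 𝔛) : 𝔛 :=
  D X (D Y Z) - D Y (D X Z) - D (K.bracket X Y) Z

/-- The curvature form of a connection, with the sign for which it gives the sectional curvature. -/
def curvatureForm (D : 𝔛 →ₗ[ℝ] 𝔛 →ₗ[ℝ] 𝔛) (X Y Z W : 𝔛) : C :=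
  -K.metric (K.curvatureOp D X Y Z) W

theorem bracket_swap (X Y : 𝔛) : K.bracket X Y = -K.bracket Y X := by
  rw [← K.torsion_free, ← K.torsion_free, neg_sub]

theorem curvatureForm_swap_left (D : 𝔛 →ₗ[ℝ] 𝔛 →ₗ[ℝ] 𝔛) (X Y Z W : 𝔛) :
    K.curvatureForm D X Y Z W = -K.curvatureForm D Y X Z W := by
  simp only [curvatureForm, curvatureOp, K.bracket_swap X Y, map_neg, map_sub,
    LinearMap.neg_apply, LinearMap.sub_apply]
  abel

theorem curvatureForm_neg (D : 𝔛 →ₗ[ℝ] 𝔛 →ₗ[ℝ] 𝔛) (X Y Z W : 𝔛) :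
    K.curvatureForm D X Y (-Z) W = -K.curvatureForm D X Y Z W := by
  simp only [curvatureForm, curvatureOp, map_neg, map_sub, LinearMap.neg_apply,
    LinearMap.sub_apply]
  abel

theorem curvatureForm_swap_right {D : 𝔛 →ₗ[ℝ] 𝔛 →ₗ[ℝ] 𝔛}
    (hD : ∀ X Y Z, K.deriv X (K.metric Y Z) = K.metric (D X Y) Z + K.metric Y (D X Z))
    (X Y Z W : 𝔛) : K.curvatureForm D X Y Z W = -K.curvatureForm D X Y W Z := by
  have h := K.deriv_bracket X Y (K.metric Z W)
  simp only [hD, map_add] at h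
  simp only [curvatureForm, curvatureOp, map_sub, LinearMap.sub_apply, K.metric_comm _ Z] at h ⊢
  linear_combination (norm := module) h

theorem curvatureOp_nabla_bianchi (X Y Z : 𝔛) :
    K.curvatureOp K.nabla X Y Z + K.curvatureOp K.nabla Y Z X
      + K.curvatureOp K.nabla Z X Y = 0 := by
  have h := K.jacobi X Y Z
  simp only [← K.torsion_free, map_sub, LinearMap.sub_apply] at h
  simp only [curvatureOp, ← K.torsion_free, map_sub, LinearMap.sub_apply]
  linear_combination (norm := module) h

theorem curvatureForm_nabla_bianchi (X Y Z W : 𝔛) :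
    K.curvatureForm K.nabla X Y Z W + K.curvatureForm K.nabla Y Z X W
      + K.curvatureForm K.nabla Z X Y W = 0 := by
  have h := congrArg (K.metric · W) (K.curvatureOp_nabla_bianchi X Y Z)
  simp only [map_add, LinearMap.add_apply, map_zero, LinearMap.zero_apply] at h
  simp only [curvatureForm]
  linear_combination (norm := module) -h

theorem curvatureForm_nabla_pair (X Y Z W : 𝔛) :
    K.curvatureForm K.nabla X Y Z W = K.curvatureForm K.nabla Z W X Y := by
  have swap_left := K.curvatureForm_swap_left K.nabla
  have swap_right := K.curvatureForm_swap_right K.deriv_metric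
  have h1 := K.curvatureForm_nabla_bianchi X Y Z W
  have h2 := K.curvatureForm_nabla_bianchi Y Z W X
  have h3 := K.curvatureForm_nabla_bianchi Z W X Y
  have h4 := K.curvatureForm_nabla_bianchi W X Y Z
  rw [swap_right Y Z W X, swap_right Z W Y X] at h2
  rw [swap_right W X Z Y, swap_left X Z W Y, swap_right Z X W Y] at h3
  rw [swap_right X Y W Z, swap_left Y W X Z, swap_right W Y X Z] at h4
  linear_combination (norm := module) (1 / 2 : ℝ) • (h1 + h2 - h3 - h4)

theorem curvatureForm_nabla_bianchi_right (W X Y Z : 𝔛) :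
    K.curvatureForm K.nabla W X Y Z + K.curvatureForm K.nabla W Y Z X
      + K.curvatureForm K.nabla W Z X Y = 0 := by
  have swap_right := K.curvatureForm_swap_right K.deriv_metric
  have h := K.curvatureForm_nabla_bianchi X Y Z W
  rw [swap_right X Y, swap_right Y Z, swap_right Z X, K.curvatureForm_nabla_pair X,
    K.curvatureForm_nabla_pair Y, K.curvatureForm_nabla_pair Z] at h
  linear_combination (norm := module) -h

end RiemannianCalculus

/-- The algebra of vector fields of an almost Hermitian manifold. -/
structure HermitianCalculus (𝔛 C : Type*) [AddCommGroup 𝔛] [Module ℝ 𝔛]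
    [AddCommGroup C] [Module ℝ C] extends RiemannianCalculus 𝔛 C where
  J : 𝔛 →ₗ[ℝ] 𝔛
  J_J : ∀ X, J (J X) = -X
  metric_J_J : ∀ X Y, metric (J X) (J Y) = metric X Y

namespace HermitianCalculus

variable {𝔛 C : Type*} [AddCommGroup 𝔛] [Module ℝ 𝔛] [AddCommGroup C] [Module ℝ C]
  (K : HermitianCalculus 𝔛 C)

/-- The tensor `∇J`, with `K.nablaJ X Y = (∇_X J) Y`. -/
def nablaJ : 𝔛 →ₗ[ℝ] 𝔛 →ₗ[ℝ] 𝔛 := K.nabla.compl₂ K.J - K.nabla.compr₂ K.J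

/-- The canonical Hermitian connection `∇̄ = ∇ - ½ J ∇J`. -/
noncomputable def canonicalConnection : 𝔛 →ₗ[ℝ] 𝔛 →ₗ[ℝ] 𝔛 :=
  K.nabla - (1 / 2 : ℝ) • K.nablaJ.compr₂ K.J

theorem nablaJ_apply (X Y : 𝔛) : K.nablaJ X Y = K.nabla X (K.J Y) - K.J (K.nabla X Y) := rfl

theorem nabla_eq (X Y : 𝔛) :
    K.nabla X Y = K.canonicalConnection X Y + (1 / 2 : ℝ) • K.J (K.nablaJ X Y) := by
  simp [canonicalConnection]

theorem metric_J_left (X Y : 𝔛) : K.metric (K.J X) Y = -K.metric X (K.J Y) := by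
  rw [← K.metric_J_J X (K.J Y), K.J_J, map_neg, neg_neg]

theorem nablaJ_J_right (X Y : 𝔛) : K.nablaJ X (K.J Y) = -K.J (K.nablaJ X Y) := by
  simp only [nablaJ_apply, map_sub, K.J_J, map_neg]
  abel

theorem metric_nablaJ_left (X Y Z : 𝔛) :
    K.metric (K.nablaJ X Y) Z = -K.metric Y (K.nablaJ X Z) := by
  have h := K.deriv_metric X (K.J Y) Z
  rw [K.metric_J_left, map_neg, K.deriv_metric, K.metric_J_left Y] at h
  simp only [nablaJ_apply, map_sub, LinearMap.sub_apply, K.metric_J_left]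
  linear_combination (norm := module) -h

theorem canonicalConnection_J (X Y : 𝔛) :
    K.canonicalConnection X (K.J Y) = K.J (K.canonicalConnection X Y) := by
  have h := K.nablaJ_apply X Y
  simp only [nabla_eq, nablaJ_J_right, map_add, map_smul, map_neg, K.J_J] at h
  linear_combination (norm := module) -h

theorem deriv_metric_canonicalConnection (X Y Z : 𝔛) :
    K.deriv X (K.metric Y Z) =
      K.metric (K.canonicalConnection X Y) Z + K.metric Y (K.canonicalConnection X Z) := by
  rw [K.deriv_metric, nabla_eq, nabla_eq]
  simp only [map_add, LinearMap.add_apply, map_smul, LinearMap.smul_apply]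
  rw [K.metric_J_left, K.metric_nablaJ_left, K.nablaJ_J_right, map_neg]
  module

theorem curvatureOp_canonicalConnection_J (X Y Z : 𝔛) :
    K.curvatureOp K.canonicalConnection X Y (K.J Z) =
      K.J (K.curvatureOp K.canonicalConnection X Y Z) := by
  simp only [RiemannianCalculus.curvatureOp, canonicalConnection_J, map_sub]

theorem curvatureForm_canonicalConnection_J_J (X Y Z W : 𝔛) :
    K.curvatureForm K.canonicalConnection X Y (K.J Z) (K.J W) =
      K.curvatureForm K.canonicalConnection X Y Z W := by
  simp only [RiemannianCalculus.curvatureForm, curvatureOp_canonicalConnection_J, K.metric_J_J]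

/-- The derivative `(∇̄_W ∇J)(X, Y)` of `∇J` for the canonical connection. -/
noncomputable def derivNablaJ (W X Y : 𝔛) : 𝔛 :=
  K.canonicalConnection W (K.nablaJ X Y) - K.nablaJ (K.canonicalConnection W X) Y
    - K.nablaJ X (K.canonicalConnection W Y)

/-- The form `⟨J (∇̄_W ∇J)(X, Y), Z⟩`. -/
noncomputable def derivNablaJForm (W X Y Z : 𝔛) : C := K.metric (K.J (K.derivNablaJ W X Y)) Z

theorem derivNablaJ_J_right (W X Y : 𝔛) :
    K.derivNablaJ W X (K.J Y) = -K.J (K.derivNablaJ W X Y) := by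
  simp only [derivNablaJ, canonicalConnection_J, nablaJ_J_right, map_neg, map_sub]
  abel

theorem metric_derivNablaJ_left (W X Y Z : 𝔛) :
    K.metric (K.derivNablaJ W X Y) Z = -K.metric Y (K.derivNablaJ W X Z) := by
  have h := K.deriv_metric_canonicalConnection W (K.nablaJ X Y) Z
  rw [K.metric_nablaJ_left, map_neg, K.deriv_metric_canonicalConnection] at h
  simp only [K.metric_nablaJ_left] at h
  simp only [derivNablaJ, map_sub, LinearMap.sub_apply, K.metric_nablaJ_left]
  linear_combination (norm := module) -h

theorem derivNablaJForm_swap_right (W X Y Z : 𝔛) :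
    K.derivNablaJForm W X Y Z = -K.derivNablaJForm W X Z Y := by
  simp only [derivNablaJForm, K.metric_J_left, K.metric_derivNablaJ_left W X Y,
    K.derivNablaJ_J_right, map_neg, neg_neg]
  rw [← K.metric_J_left, K.metric_comm]

theorem derivNablaJForm_J_right (W X Y Z : 𝔛) :
    K.derivNablaJForm W X (K.J Y) Z = K.derivNablaJForm W X Y (K.J Z) := by
  simp only [derivNablaJForm, K.derivNablaJ_J_right, map_neg, LinearMap.neg_apply,
    K.metric_J_left (K.J _), neg_neg]

theorem derivNablaJForm_neg_neg (W X Y Z : 𝔛) :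
    K.derivNablaJForm (-W) (-X) Y Z = K.derivNablaJForm W X Y Z := by
  simp [derivNablaJForm, derivNablaJ]

theorem derivNablaJForm_neg_left (W X Y Z : 𝔛) :
    K.derivNablaJForm W (-X) Y Z = -K.derivNablaJForm W X Y Z := by
  simp only [derivNablaJForm, derivNablaJ, map_neg, map_sub, LinearMap.neg_apply,
    LinearMap.sub_apply]
  abel

/-- `(M, g, J)` is nearly Kähler: `(∇_X J) X = 0` for every vector field `X`. -/
def IsNearlyKahler : Prop := ∀ X, K.nablaJ X X = 0

namespace IsNearlyKahler

variable {K} (h : K.IsNearlyKahler)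
include h

theorem nablaJ_swap (X Y : 𝔛) : K.nablaJ X Y = -K.nablaJ Y X := by
  have hXY := h (X + Y)
  simp only [map_add, LinearMap.add_apply, h X, h Y, zero_add, add_zero] at hXY
  exact eq_neg_of_add_eq_zero_right hXY

theorem nablaJ_J_left (X Y : 𝔛) : K.nablaJ (K.J X) Y = -K.J (K.nablaJ X Y) := by
  rw [h.nablaJ_swap, K.nablaJ_J_right, h.nablaJ_swap Y X, map_neg, neg_neg]

theorem metric_nablaJ_nablaJ (X Y Z W : 𝔛) :
    K.metric (K.nablaJ (K.nablaJ X Y) Z) W = K.metric (K.nablaJ X Y) (K.nablaJ Z W) := by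
  rw [h.nablaJ_swap, map_neg, LinearMap.neg_apply, K.metric_nablaJ_left, neg_neg]

theorem bracket_eq (X Y : 𝔛) :
    K.bracket X Y =
      K.canonicalConnection X Y - K.canonicalConnection Y X + K.J (K.nablaJ X Y) := by
  rw [← K.torsion_free, K.nabla_eq, K.nabla_eq, h.nablaJ_swap Y X, map_neg]
  module

theorem derivNablaJForm_swap_left (W X Y Z : 𝔛) :
    K.derivNablaJForm W X Y Z = -K.derivNablaJForm W Y X Z := by
  have hXY : K.derivNablaJ W X Y = -K.derivNablaJ W Y X := by
    simp only [HermitianCalculus.derivNablaJ]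
    rw [h.nablaJ_swap X Y, h.nablaJ_swap (K.canonicalConnection W X) Y,
      h.nablaJ_swap X (K.canonicalConnection W Y), map_neg]
    abel
  simp only [derivNablaJForm, hXY, map_neg, LinearMap.neg_apply]

theorem derivNablaJForm_J_left (W X Y Z : 𝔛) :
    K.derivNablaJForm W (K.J X) Y Z = K.derivNablaJForm W X (K.J Y) Z := by
  rw [h.derivNablaJForm_swap_left, K.derivNablaJForm_J_right, h.derivNablaJForm_swap_left W Y,
    neg_neg, K.derivNablaJForm_J_right]

theorem derivNablaJForm_J_J (W X Y Z : 𝔛) :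
    K.derivNablaJForm W (K.J X) (K.J Y) Z = -K.derivNablaJForm W X Y Z := by
  rw [← h.derivNablaJForm_J_left, K.J_J, derivNablaJForm_neg_left]

theorem derivNablaJForm_rotate (W X Y Z : 𝔛) :
    K.derivNablaJForm W Y Z X = K.derivNablaJForm W X Y Z := by
  rw [K.derivNablaJForm_swap_right, h.derivNablaJForm_swap_left, neg_neg]

theorem curvatureOp_nabla_add (W X Y : 𝔛) :
    K.curvatureOp K.nabla W X Y + K.J (K.curvatureOp K.nabla W X (K.J Y)) =
      K.J (K.derivNablaJ W X Y - K.derivNablaJ X W Y) - K.nablaJ (K.nablaJ W X) Y := by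
  simp only [RiemannianCalculus.curvatureOp, h.bracket_eq, K.nabla_eq, derivNablaJ, map_add,
    map_sub, map_neg, map_smul, LinearMap.add_apply, LinearMap.sub_apply, K.canonicalConnection_J,
    K.nablaJ_J_right, h.nablaJ_J_left, K.J_J]
  module

theorem curvatureForm_nabla_sub (W X Y Z : 𝔛) :
    K.curvatureForm K.nabla W X Y Z - K.curvatureForm K.nabla W X (K.J Y) (K.J Z) =
      K.metric (K.nablaJ W X) (K.nablaJ Y Z)
        - (K.derivNablaJForm W X Y Z - K.derivNablaJForm X W Y Z) := by
  have hR := congrArg (K.metric · Z) (h.curvatureOp_nabla_add W X Y)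
  simp only [map_add, map_sub, LinearMap.add_apply, LinearMap.sub_apply, h.metric_nablaJ_nablaJ,
    K.metric_J_left (K.curvatureOp _ _ _ _)] at hR
  simp only [RiemannianCalculus.curvatureForm, derivNablaJForm]
  linear_combination (norm := module) -hR

/-- The terms quadratic in `∇J` cancel, so that only its derivative remains. -/
theorem curvatureForm_nabla_sub_sub_sub (W X Y Z : 𝔛) :
    K.curvatureForm K.nabla W X Y Z - K.curvatureForm K.nabla W X (K.J Y) (K.J Z)
        - K.curvatureForm K.nabla W (K.J X) Y (K.J Z)
        - K.curvatureForm K.nabla W (K.J X) (K.J Y) Z =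
      K.derivNablaJForm X W Y Z - K.derivNablaJForm (K.J X) (K.J W) Y Z
        - (2 : ℝ) • K.derivNablaJForm W X Y Z := by
  have h1 := h.curvatureForm_nabla_sub W X Y Z
  have h2 := h.curvatureForm_nabla_sub W (K.J X) (K.J Y) Z
  rw [K.nablaJ_J_right, h.nablaJ_J_left Y, map_neg, map_neg, LinearMap.neg_apply, neg_neg,
    K.metric_J_J, K.J_J, RiemannianCalculus.curvatureForm_neg,
    h.derivNablaJForm_J_J, ← h.derivNablaJForm_J_left (K.J X)] at h2
  linear_combination (norm := module) h1 - h2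

/-- In the cyclic sum over `X`, `Y`, `Z` the curvature cancels by the Bianchi identity. -/
theorem six_smul_derivNablaJForm (W X Y Z : 𝔛) :
    (6 : ℝ) • K.derivNablaJForm W X Y Z =
      K.derivNablaJForm X W Y Z + K.derivNablaJForm Y W Z X + K.derivNablaJForm Z W X Y
        - (K.derivNablaJForm (K.J X) (K.J W) Y Z + K.derivNablaJForm (K.J Y) (K.J W) Z X
          + K.derivNablaJForm (K.J Z) (K.J W) X Y) := by
  have hX := h.curvatureForm_nabla_sub_sub_sub W X Y Z
  have hY := h.curvatureForm_nabla_sub_sub_sub W Y Z X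
  have hZ := h.curvatureForm_nabla_sub_sub_sub W Z X Y
  rw [h.derivNablaJForm_rotate W X Y Z] at hY
  rw [← h.derivNablaJForm_rotate W Z X Y] at hZ
  linear_combination (norm := module) hX + hY + hZ
    - K.curvatureForm_nabla_bianchi_right W X Y Z
    + K.curvatureForm_nabla_bianchi_right W X (K.J Y) (K.J Z)
    + K.curvatureForm_nabla_bianchi_right W Y (K.J Z) (K.J X)
    + K.curvatureForm_nabla_bianchi_right W Z (K.J X) (K.J Y)

theorem derivNablaJForm_J_J_left (W X Y Z : 𝔛) :
    K.derivNablaJForm (K.J W) (K.J X) Y Z = -K.derivNablaJForm W X Y Z := by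
  have h1 := h.six_smul_derivNablaJForm W X Y Z
  have h2 := h.six_smul_derivNablaJForm (K.J W) (K.J X) Y Z
  have J_swap (V U T S : 𝔛) :
      K.derivNablaJForm V (K.J U) T S = K.derivNablaJForm V U T (K.J S) := by
    rw [h.derivNablaJForm_J_left, K.derivNablaJForm_J_right]
  rw [K.J_J, K.J_J, K.derivNablaJForm_neg_neg, K.derivNablaJForm_neg_left,
    K.derivNablaJForm_neg_left, h.derivNablaJForm_J_J Z, h.derivNablaJForm_rotate Y (K.J X),
    h.derivNablaJForm_J_J Y, ← h.derivNablaJForm_rotate Y, ← J_swap (K.J Y),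
    ← h.derivNablaJForm_J_left (K.J Z)] at h2
  linear_combination (norm := module) (1 / 6 : ℝ) • (h1 + h2)

theorem three_smul_derivNablaJForm (W X Y Z : 𝔛) :
    (3 : ℝ) • K.derivNablaJForm W X Y Z =
      K.derivNablaJForm X W Y Z + K.derivNablaJForm Y W Z X + K.derivNablaJForm Z W X Y := by
  have h1 := h.six_smul_derivNablaJForm W X Y Z
  simp only [h.derivNablaJForm_J_J_left] at h1
  linear_combination (norm := module) (1 / 2 : ℝ) • h1

/-- Kirichenko's theorem. -/
theorem derivNablaJ_eq_zero (W X Y : 𝔛) : K.derivNablaJ W X Y = 0 := by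
  suffices hJ : K.J (K.derivNablaJ W X Y) = 0 by
    rw [← neg_neg (K.derivNablaJ W X Y), ← K.J_J (K.derivNablaJ W X Y), hJ, map_zero, neg_zero]
  refine K.ext_metric fun Z => ?_
  rw [map_zero, LinearMap.zero_apply]
  have hW := h.three_smul_derivNablaJForm W X Y Z
  have hX := h.three_smul_derivNablaJForm X W Y Z
  have hY := h.three_smul_derivNablaJForm Y W Z X
  have hZ := h.three_smul_derivNablaJForm Z W X Y
  rw [← h.derivNablaJForm_rotate Y X Z W, h.derivNablaJForm_swap_left Y Z,
    h.derivNablaJForm_swap_left Z X] at hX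
  rw [h.derivNablaJForm_rotate W X Y Z, ← h.derivNablaJForm_rotate Z Y X W,
    h.derivNablaJForm_swap_left Z X, h.derivNablaJForm_swap_left X Y] at hY
  rw [← h.derivNablaJForm_rotate W Z X Y, ← h.derivNablaJForm_rotate X Z Y W,
    h.derivNablaJForm_swap_left X Y, h.derivNablaJForm_swap_left Y Z] at hZ
  change K.derivNablaJForm W X Y Z = 0
  linear_combination (norm := module) (1 / 12 : ℝ) • ((5 : ℝ) • hW + hX + hY + hZ)

theorem canonicalConnection_nablaJ (W X Y : 𝔛) :
    K.canonicalConnection W (K.nablaJ X Y) =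
      K.nablaJ (K.canonicalConnection W X) Y + K.nablaJ X (K.canonicalConnection W Y) := by
  rw [← sub_eq_zero, ← sub_sub]
  exact h.derivNablaJ_eq_zero W X Y

theorem curvatureForm_nabla_sub_J_J (W X Y Z : 𝔛) :
    K.curvatureForm K.nabla W X Y Z - K.curvatureForm K.nabla W X (K.J Y) (K.J Z) =
      K.metric (K.nablaJ W X) (K.nablaJ Y Z) := by
  simp [h.curvatureForm_nabla_sub, derivNablaJForm, h.derivNablaJ_eq_zero]

theorem curvatureOp_canonicalConnection_nablaJ (X Y Z W : 𝔛) :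
    K.curvatureOp K.canonicalConnection X Y (K.nablaJ Z W) =
      K.nablaJ (K.curvatureOp K.canonicalConnection X Y Z) W
        + K.nablaJ Z (K.curvatureOp K.canonicalConnection X Y W) := by
  simp only [RiemannianCalculus.curvatureOp, h.canonicalConnection_nablaJ, map_add, map_sub,
    LinearMap.sub_apply]
  abel

theorem curvatureForm_canonicalConnection_nablaJ (X Y Z W V : 𝔛) :
    K.curvatureForm K.canonicalConnection X Y (K.nablaJ Z W) V =
      K.curvatureForm K.canonicalConnection X Y Z (K.nablaJ W V)
        - K.curvatureForm K.canonicalConnection X Y W (K.nablaJ Z V) := by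
  simp only [RiemannianCalculus.curvatureForm, h.curvatureOp_canonicalConnection_nablaJ, map_add,
    LinearMap.add_apply, K.metric_nablaJ_left Z]
  rw [h.nablaJ_swap, map_neg, LinearMap.neg_apply, K.metric_nablaJ_left]
  abel

theorem curvatureOp_nabla_eq (X Y Z : 𝔛) :
    K.curvatureOp K.nabla X Y Z =
      K.curvatureOp K.canonicalConnection X Y Z - (1 / 2 : ℝ) • K.nablaJ (K.nablaJ X Y) Z
        + (1 / 4 : ℝ) • (K.nablaJ X (K.nablaJ Y Z) - K.nablaJ Y (K.nablaJ X Z)) := by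
  simp only [RiemannianCalculus.curvatureOp, h.bracket_eq, K.nabla_eq, map_add, map_smul, map_sub,
    LinearMap.add_apply, LinearMap.sub_apply, K.canonicalConnection_J, K.nablaJ_J_right,
    h.nablaJ_J_left, h.canonicalConnection_nablaJ, K.J_J, map_neg]
  module

theorem curvatureForm_canonicalConnection_eq (X Y Z W : 𝔛) :
    K.curvatureForm K.canonicalConnection X Y Z W =
      K.curvatureForm K.nabla X Y Z W
        - (1 / 2 : ℝ) • K.metric (K.nablaJ X Y) (K.nablaJ Z W)
        + (1 / 4 : ℝ) • (K.metric (K.nablaJ X Z) (K.nablaJ Y W)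
          - K.metric (K.nablaJ Y Z) (K.nablaJ X W)) := by
  simp only [RiemannianCalculus.curvatureForm, h.curvatureOp_nabla_eq, map_add, map_sub, map_smul,
    LinearMap.add_apply, LinearMap.sub_apply, LinearMap.smul_apply, h.metric_nablaJ_nablaJ,
    K.metric_nablaJ_left X (K.nablaJ _ _), K.metric_nablaJ_left Y (K.nablaJ _ _)]
  module

end IsNearlyKahler
end HermitianCalculus
end NearlyKahler

/-! ### The Ricci form of the canonical connection -/

namespace NearlyKahler

section Contraction

variable {V : Type*} [NormedAddCommGroup V] [InnerProductSpace ℝ V]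
  {ι : Type*} [Fintype ι] (e : OrthonormalBasis ι ℝ V)

theorem sum_apply_self_eq {κ : Type*} [Fintype κ] (f : OrthonormalBasis κ ℝ V)
    (F : V →ₗ[ℝ] V →ₗ[ℝ] ℝ) : ∑ i, F (e i) (e i) = ∑ k, F (f k) (f k) := by
  have : FiniteDimensional ℝ V := e.toBasis.finiteDimensional_of_finite
  have h := congrArg (TensorProduct.lift F)
    ((InnerProductSpace.canonicalCovariantTensor_eq_sum V e).symm.trans
      (InnerProductSpace.canonicalCovariantTensor_eq_sum V f))
  simpa using h

theorem sum_apply_eq_of_inner_eq (F : V →ₗ[ℝ] V →ₗ[ℝ] ℝ) {t s : ι → V}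
    (h : ∀ i j, inner ℝ (t i) (e j) = inner ℝ (e i) (s j)) :
    ∑ i, F (t i) (e i) = ∑ i, F (e i) (s i) := by
  have ht (i) : F (t i) (e i) = ∑ j, inner ℝ (e j) (t i) * F (e j) (e i) := by
    conv_lhs => rw [← e.sum_repr' (t i)]
    simp
  have hs (j) : F (e j) (s j) = ∑ i, inner ℝ (e i) (s j) * F (e j) (e i) := by
    conv_lhs => rw [← e.sum_repr' (s j)]
    simp
  simp only [ht, hs]
  rw [Finset.sum_comm]
  simp only [real_inner_comm (t _), h]

theorem sum_apply_adjoint (F : V →ₗ[ℝ] V →ₗ[ℝ] ℝ) {T S : V → V}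
    (h : ∀ u v, inner ℝ (T u) v = inner ℝ u (S v)) :
    ∑ i, F (T (e i)) (e i) = ∑ i, F (e i) (S (e i)) :=
  sum_apply_eq_of_inner_eq e F fun _ _ => h _ _

theorem sum_apply_eq_zero_of_anticommute {J T : V →ₗ[ℝ] V} (hJJ : ∀ u, J (J u) = -u)
    (hJ : ∀ u v, inner ℝ (J u) (J v) = inner ℝ u v) (hT : ∀ u, T (J u) = -J (T u))
    (F : V →ₗ[ℝ] V →ₗ[ℝ] ℝ) (hF : ∀ u v, F (J u) (J v) = F u v) :
    ∑ i, F (e i) (T (e i)) = 0 := by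
  have hadj (u v : V) : inner ℝ (J u) v = inner ℝ u (-J v) := by
    rw [← hJ u, map_neg, hJJ, neg_neg]
  have h := sum_apply_adjoint e (F.compl₂ (T ∘ₗ J)) hadj
  simp only [LinearMap.compl₂_apply, LinearMap.comp_apply, map_neg, hJJ, neg_neg, hT, hF,
    Finset.sum_neg_distrib] at h
  linarith

end Contraction

/-- The tensors at a point of a nearly Kähler manifold: `nablaJ` is `∇J` and `curv` is the curvature
form of the canonical connection. The Bianchi identity of `curv` has a right-hand side because the
canonical connection has torsion. -/
structure TangentModel (V : Type*) [NormedAddCommGroup V] [InnerProductSpace ℝ V] where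
  J : V →ₗ[ℝ] V
  nablaJ : V →ₗ[ℝ] V →ₗ[ℝ] V
  curv : V →ₗ[ℝ] V →ₗ[ℝ] V →ₗ[ℝ] V →ₗ[ℝ] ℝ
  J_J : ∀ u, J (J u) = -u
  inner_J_J : ∀ u v, inner ℝ (J u) (J v) = inner ℝ u v
  nablaJ_swap : ∀ u v, nablaJ u v = -nablaJ v u
  nablaJ_J : ∀ u v, nablaJ u (J v) = -J (nablaJ u v)
  inner_nablaJ : ∀ u v w, inner ℝ (nablaJ u v) w = -inner ℝ v (nablaJ u w)
  curv_swap_right : ∀ a b c d, curv a b c d = -curv a b d c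
  curv_pair : ∀ a b c d, curv a b c d = curv c d a b
  curv_bianchi : ∀ a b c d, curv a b c d + curv b c a d + curv c a b d =
    -(inner ℝ (nablaJ a b) (nablaJ c d) + inner ℝ (nablaJ b c) (nablaJ a d)
      + inner ℝ (nablaJ c a) (nablaJ b d))
  curv_nablaJ : ∀ a b c d f,
    curv a b (nablaJ c d) f = curv a b c (nablaJ d f) - curv a b d (nablaJ c f)
  curv_J_J : ∀ a b c d, curv a b (J c) (J d) = curv a b c d

namespace TangentModel

variable {V : Type*} [NormedAddCommGroup V] [InnerProductSpace ℝ V] (P : TangentModel V)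
  {ι : Type*} [Fintype ι] (e : OrthonormalBasis ι ℝ V)

/-- The Ricci form of the canonical connection. -/
noncomputable def ricci (z w : V) : ℝ := ∑ i, P.curv z (e i) w (e i)

theorem ricci_comm (z w : V) : P.ricci e z w = P.ricci e w z := by
  simp only [ricci, P.curv_pair z]

theorem ricci_smul (c : ℝ) (z w : V) : P.ricci e z (c • w) = c * P.ricci e z w := by
  simp [ricci, Finset.mul_sum]

theorem nablaJ_J_left (u v : V) : P.nablaJ (P.J u) v = -P.J (P.nablaJ u v) := by
  rw [P.nablaJ_swap, P.nablaJ_J, P.nablaJ_swap v u, map_neg, neg_neg]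

theorem inner_nablaJ_eq_inner_neg (u v w : V) :
    inner ℝ (P.nablaJ u v) w = inner ℝ v (-P.nablaJ u w) := by
  rw [P.inner_nablaJ, inner_neg_right]

theorem inner_nablaJ_nablaJ (u v a b : V) :
    inner ℝ (P.nablaJ u (P.nablaJ v a)) b = inner ℝ a (P.nablaJ v (P.nablaJ u b)) := by
  rw [P.inner_nablaJ, P.inner_nablaJ, neg_neg]

theorem sum_inner_nablaJ_nablaJ_nablaJ_eq_zero (a x w : V) :
    ∑ m, inner ℝ a (P.nablaJ (e m) (P.nablaJ w (P.nablaJ x (e m)))) = 0 :=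
  sum_apply_eq_zero_of_anticommute e P.J_J P.inner_J_J (P.nablaJ_J x)
    ((P.nablaJ.compl₂ (P.nablaJ w)).compr₂ (innerₗ V a)) fun u v => by
      simp [P.nablaJ_J, P.nablaJ_J_left, P.J_J]

theorem sum_curv_nablaJ_nablaJ_eq_zero (z w : V) :
    ∑ k, ∑ m, P.curv z (P.nablaJ w (P.nablaJ (e k) (e m))) (e k) (e m) = 0 := by
  have move (k) : ∑ m, P.curv z (P.nablaJ w (P.nablaJ (e k) (e m))) (e k) (e m) =
      ∑ m, P.curv z (e m) (e k) (-P.nablaJ (P.nablaJ w (e m)) (e k)) := by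
    have h := sum_apply_adjoint e ((P.curv z).flip (e k)) (P.inner_nablaJ_nablaJ w (e k))
    simpa only [LinearMap.flip_apply, P.nablaJ_swap (e k) (P.nablaJ w _)] using h
  simp only [move]
  rw [Finset.sum_comm]
  refine Finset.sum_eq_zero fun m _ => ?_
  simp only [map_neg, Finset.sum_neg_distrib, neg_eq_zero]
  exact sum_apply_eq_zero_of_anticommute e P.J_J P.inner_J_J (P.nablaJ_J _) _ (P.curv_J_J z (e m))

theorem curv_sub_curv (z k m n : V) :
    P.curv z k m n - P.curv z m k n =
      -P.curv z n k m - inner ℝ (P.nablaJ z k) (P.nablaJ m n)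
        - inner ℝ (P.nablaJ k m) (P.nablaJ z n) - inner ℝ (P.nablaJ m z) (P.nablaJ k n) := by
  have h := P.curv_bianchi z k m n
  rw [P.curv_pair m z, P.curv_swap_right k n m z, P.curv_pair k n z m, P.curv_pair k m] at h
  linarith

section Ricci

variable {r : V →ₗ[ℝ] V}
  (hr : ∀ u v, inner ℝ (r u) v = ∑ k, inner ℝ (P.nablaJ (e k) u) (P.nablaJ (e k) v))
include hr

theorem inner_r_comm (u v : V) : inner ℝ (r u) v = inner ℝ u (r v) := by
  simp only [real_inner_comm (r v) u, hr, real_inner_comm (P.nablaJ _ v)]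

theorem sum_nablaJ_nablaJ (w : V) : ∑ k, P.nablaJ (e k) (P.nablaJ (e k) w) = -r w := by
  refine ext_inner_right ℝ fun v => ?_
  simp only [inner_neg_left, hr, sum_inner, ← Finset.sum_neg_distrib, P.inner_nablaJ]

theorem ricci_r_eq_sum_curv (z w : V) :
    P.ricci e z (r w) =
      2 * ∑ k, ∑ m, P.curv z (e k) (e m) (P.nablaJ w (P.nablaJ (e k) (e m))) := by
  have expand : P.ricci e z (r w) =
      ∑ k, ∑ j, P.curv z (e k) (e k) (P.nablaJ (e j) (P.nablaJ (e j) w)) := by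
    refine Finset.sum_congr rfl fun k _ => ?_
    rw [← map_sum, P.sum_nablaJ_nablaJ e hr, map_neg, P.curv_swap_right]
  have leibniz (k j) : P.curv z (e k) (e k) (P.nablaJ (e j) (P.nablaJ (e j) w)) =
      P.curv z (e k) (P.nablaJ (e k) (e j)) (P.nablaJ (e j) w)
        + P.curv z (e k) (e j) (P.nablaJ (e k) (P.nablaJ (e j) w)) := by
    rw [P.curv_nablaJ, sub_add_cancel]
  have first (k) : ∑ j, P.curv z (e k) (P.nablaJ (e k) (e j)) (P.nablaJ (e j) w) =
      ∑ j, P.curv z (e k) (e j) (P.nablaJ w (P.nablaJ (e k) (e j))) := by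
    have h := sum_apply_adjoint e ((P.curv z (e k)).compl₂ (P.nablaJ w))
      (P.inner_nablaJ_eq_inner_neg (e k))
    simpa only [LinearMap.compl₂_apply, map_neg, P.nablaJ_swap _ w, Finset.sum_neg_distrib,
      neg_inj, neg_neg] using congrArg Neg.neg h
  have second (k) : ∑ j, P.curv z (e k) (e j) (P.nablaJ (e k) (P.nablaJ (e j) w)) =
      ∑ j, P.curv z (e k) (e j) (P.nablaJ w (P.nablaJ (e k) (e j))) := by
    have h := sum_apply_adjoint e (P.curv z (e k)) (P.inner_nablaJ_nablaJ w (e k))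
    simp only [P.curv_swap_right z (e k) (P.nablaJ w _), Finset.sum_neg_distrib] at h
    simp only [P.nablaJ_swap _ w, map_neg, Finset.sum_neg_distrib, ← h, neg_neg]
  rw [expand, Finset.mul_sum]
  refine Finset.sum_congr rfl fun k _ => ?_
  simp only [leibniz, Finset.sum_add_distrib, first, second, two_mul]

theorem sum_inner_nablaJ_nablaJ_nablaJ (z w : V) :
    ∑ k, ∑ m, inner ℝ (P.nablaJ (e k) (e m)) (P.nablaJ z (P.nablaJ w (P.nablaJ (e k) (e m)))) =
      -∑ i, inner ℝ (P.nablaJ z (e i)) (P.nablaJ w (r (e i))) := by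
  have move (k) :
      ∑ m, inner ℝ (P.nablaJ (e k) (e m)) (P.nablaJ z (P.nablaJ w (P.nablaJ (e k) (e m)))) =
        ∑ m, inner ℝ (P.nablaJ z (e m)) (P.nablaJ w (P.nablaJ (e k) (P.nablaJ (e k) (e m)))) := by
    have h := sum_apply_adjoint e ((innerₗ V).compl₁₂ (P.nablaJ z) (P.nablaJ w ∘ₗ P.nablaJ (e k)))
      (P.inner_nablaJ_eq_inner_neg (e k))
    simp only [LinearMap.compl₁₂_apply, LinearMap.comp_apply, innerₗ_apply_apply, map_neg]
      at h
    rw [← neg_inj, ← Finset.sum_neg_distrib, ← Finset.sum_neg_distrib, ← h]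
    simp only [P.inner_nablaJ z]
  simp only [move]
  rw [Finset.sum_comm]
  simp only [← inner_sum, ← map_sum, P.sum_nablaJ_nablaJ e hr, map_neg, inner_neg_right,
    Finset.sum_neg_distrib]

theorem ricci_r (z w : V) :
    P.ricci e z (r w) = ∑ i, inner ℝ (P.nablaJ z (e i)) (P.nablaJ w (r (e i))) := by
  rw [P.ricci_r_eq_sum_curv e hr]
  let n (k m : ι) : V := P.nablaJ w (P.nablaJ (e k) (e m))
  have n_swap (k m) : n k m = -n m k := by
    simp only [n, P.nablaJ_swap (e k) (e m), map_neg]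
  have skew : ∑ k, ∑ m, P.curv z (e k) (e m) (n k m) =
      -∑ k, ∑ m, P.curv z (e m) (e k) (n k m) := by
    rw [Finset.sum_comm]
    simp only [← Finset.sum_neg_distrib]
    refine Finset.sum_congr rfl fun k _ => Finset.sum_congr rfl fun m _ => ?_
    rw [n_swap m k, map_neg]
  have vanish₁ : ∑ k, ∑ m, inner ℝ (P.nablaJ z (e k)) (P.nablaJ (e m) (n k m)) = 0 :=
    Finset.sum_eq_zero fun k _ => P.sum_inner_nablaJ_nablaJ_nablaJ_eq_zero e _ _ _
  have vanish₂ : ∑ k, ∑ m, inner ℝ (P.nablaJ (e m) z) (P.nablaJ (e k) (n k m)) = 0 := by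
    rw [Finset.sum_comm]
    refine Finset.sum_eq_zero fun k _ => ?_
    simp only [n_swap _ k, map_neg, inner_neg_right, Finset.sum_neg_distrib, neg_eq_zero]
    exact P.sum_inner_nablaJ_nablaJ_nablaJ_eq_zero e _ _ _
  have bianchi : ∑ k, ∑ m, (P.curv z (e k) (e m) (n k m) - P.curv z (e m) (e k) (n k m)) = _ :=
    Finset.sum_congr rfl fun k _ => Finset.sum_congr rfl fun m _ => P.curv_sub_curv _ _ _ _
  simp only [Finset.sum_sub_distrib, Finset.sum_neg_distrib] at bianchi
  rw [vanish₁, vanish₂, P.sum_curv_nablaJ_nablaJ_eq_zero,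
    P.sum_inner_nablaJ_nablaJ_nablaJ e hr] at bianchi
  linarith

theorem ricci_r_comm (z w : V) : P.ricci e z (r w) = P.ricci e w (r z) := by
  have h := sum_apply_adjoint e ((innerₗ V).compl₁₂ (P.nablaJ z) (P.nablaJ w)) (P.inner_r_comm e hr)
  simp only [LinearMap.compl₁₂_apply, innerₗ_apply_apply] at h
  rw [P.ricci_r e hr, P.ricci_r e hr, ← h]
  exact Finset.sum_congr rfl fun i _ => real_inner_comm _ _

theorem ricci_eq_zero_of_eigenvectors {c d : ℝ} (hcd : c ≠ d) {u v : V} (hu : r u = c • u)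
    (hv : r v = d • v) : P.ricci e u v = 0 := by
  have h := P.ricci_r_comm e hr u v
  rw [hu, hv, P.ricci_smul, P.ricci_smul, P.ricci_comm e v] at h
  exact (mul_eq_zero.mp (by linarith : (c - d) * P.ricci e u v = 0)).resolve_left
    (sub_ne_zero.mpr hcd)

theorem ricci_eq_of_eigenvector {c : ℝ} (hc : c ≠ 0) {u v : V} (hv : r v = c • v) :
    P.ricci e u v = 1 / c * ∑ i, inner ℝ (P.nablaJ u (e i)) (P.nablaJ v (r (e i))) := by
  rw [← P.ricci_r e hr, hv, P.ricci_smul, one_div, inv_mul_cancel_left₀ hc]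

end Ricci

end TangentModel
end NearlyKahler

/-! ### Smooth vector fields -/

namespace NearlyKahler

open Filter Topology

variable {E : Type*} [NormedAddCommGroup E] [NormedSpace ℝ E] [FiniteDimensional ℝ E]
  {M : Type*} [TopologicalSpace M] [ChartedSpace E M] [IsManifold 𝓘(ℝ, E) ∞ M]

variable (E M) in
/-- The smooth vector fields on `M`. -/
abbrev VF := Cₛ^∞⟮𝓘(ℝ, E); E, fun x : M => TangentSpace 𝓘(ℝ, E) x⟯

variable (E M) in
/-- The smooth functions on `M`. -/
abbrev SF := C^∞⟮𝓘(ℝ, E), M; 𝓘(ℝ, ℝ), ℝ⟯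

theorem exists_vectorField_eventuallyEq [T2Space M] {x : M} {U : Set M} (hU : U ∈ 𝓝 x)
    {s : Π y : M, TangentSpace 𝓘(ℝ, E) y} (hs : CMDiff[U] ∞ (T% s)) :
    ∃ X : VF E M, ⇑X =ᶠ[𝓝 x] s := by
  obtain ⟨f, -, hf⟩ := (SmoothBumpFunction.nhds_basis_tsupport (I := 𝓘(ℝ, E)) x).mem_iff.mp
    (interior_mem_nhds.mpr hU)
  refine ⟨⟨(f : M → ℝ) • s, ContMDiffOn.smul_section_of_tsupport f.contMDiff.contMDiffOn
    isOpen_interior hf (hs.mono interior_subset)⟩, ?_⟩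
  filter_upwards [f.eventuallyEq_one] with y hy
  change f y • s y = s y
  rw [hy, Pi.one_apply, one_smul]

theorem exists_vectorField_extend [T2Space M] {x : M} (v : TangentSpace 𝓘(ℝ, E) x) :
    ∃ X : VF E M, ⇑X =ᶠ[𝓝 x] (extend E v : Π y : M, TangentSpace 𝓘(ℝ, E) y) := by
  obtain ⟨U, hU, hs⟩ := exists_contMDiffOn_extend (k := ∞) 𝓘(ℝ, E) E v
  exact exists_vectorField_eventuallyEq hU hs

theorem exists_vectorField_apply_eq [T2Space M] {x : M} (v : TangentSpace 𝓘(ℝ, E) x) :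
    ∃ X : VF E M, X x = v := by
  obtain ⟨X, hX⟩ := exists_vectorField_extend v
  exact ⟨X, by rw [hX.eq_of_nhds, extend_apply_self]⟩

section Frames

variable [RiemannianBundle (fun x : M => TangentSpace 𝓘(ℝ, E) x)]
  [IsContMDiffRiemannianBundle 𝓘(ℝ, E) ∞ E (fun x : M => TangentSpace 𝓘(ℝ, E) x)]

omit [FiniteDimensional ℝ E] in
theorem contMDiffOn_inner {U : Set M} {X Y : Π y : M, TangentSpace 𝓘(ℝ, E) y}
    (hX : CMDiff[U] ∞ (T% X)) (hY : CMDiff[U] ∞ (T% Y)) :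
    CMDiff[U] ∞ (fun y => inner ℝ (X y) (Y y)) :=
  ContMDiffOn.inner_bundle (IB := 𝓘(ℝ, E)) (F := E) (E := fun y : M => TangentSpace 𝓘(ℝ, E) y)
    (b := fun y => y) hX hY

omit [FiniteDimensional ℝ E] in
theorem contMDiffOn_gramSchmidt {n : ℕ} {U : Set M}
    {s : Fin n → Π y : M, TangentSpace 𝓘(ℝ, E) y} (hs : ∀ i, CMDiff[U] ∞ (T% (s i)))
    (hli : ∀ y ∈ U, LinearIndependent ℝ (s · y)) (i : Fin n) :
    CMDiff[U] ∞ (T% (fun y => InnerProductSpace.gramSchmidt ℝ (s · y) i)) := by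
  induction i using WellFoundedLT.induction with
  | ind i ih =>
    have h0 : ∀ j, ∀ y ∈ U, InnerProductSpace.gramSchmidt ℝ (s · y) j ≠ 0 := fun j y hy =>
      InnerProductSpace.gramSchmidt_ne_zero j (hli y hy)
    have h1 : CMDiff[U] ∞ (T% (fun y => ∑ j ∈ Finset.Iio i,
        (inner ℝ (InnerProductSpace.gramSchmidt ℝ (s · y) j) (s i y)
          / inner ℝ (InnerProductSpace.gramSchmidt ℝ (s · y) j)
            (InnerProductSpace.gramSchmidt ℝ (s · y) j))
          • InnerProductSpace.gramSchmidt ℝ (s · y) j)) := by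
      refine ContMDiffOn.sum_section fun j hj => ?_
      have hj := ih j (Finset.mem_Iio.mp hj)
      refine ContMDiffOn.smul_section (ContMDiffOn.div₀ (contMDiffOn_inner hj (hs i))
        (contMDiffOn_inner hj hj) fun y hy => ?_) hj
      exact inner_self_ne_zero.mpr (h0 j y hy)
    refine ((hs i).sub_section h1).congr fun y _ => ?_
    rw [TotalSpace.mk_inj, Pi.sub_apply, eq_sub_iff_add_eq]
    conv_rhs => rw [InnerProductSpace.gramSchmidt_def'' ℝ (s · y) i]
    simp

theorem exists_orthonormal_vectorFields [T2Space M] (x : M) :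
    ∃ e : Fin (Module.finrank ℝ E) → VF E M, ∀ᶠ y in 𝓝 x, Orthonormal ℝ (fun i => e i y) := by
  let t := trivializationAt E (fun y : M => TangentSpace 𝓘(ℝ, E) y) x
  let b := Module.finBasis ℝ E
  have hf := t.isLocalFrameOn_localFrame_baseSet 𝓘(ℝ, E) ∞ b
  have hU : t.baseSet ∈ 𝓝 x := t.open_baseSet.mem_nhds (mem_baseSet_trivializationAt' x)
  have hg := contMDiffOn_gramSchmidt hf.contMDiffOn (fun y hy => hf.linearIndependent hy)
  have hn : ∀ i, CMDiff[t.baseSet] ∞ (T% (fun y =>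
      InnerProductSpace.gramSchmidtNormed ℝ (t.localFrame b · y) i)) := by
    intro i
    refine ContMDiffOn.smul_section (f := fun y =>
      (‖InnerProductSpace.gramSchmidt ℝ (t.localFrame b · y) i‖⁻¹ : ℝ)) ?_ (hg i)
    have h0 : ∀ y ∈ t.baseSet, InnerProductSpace.gramSchmidt ℝ (t.localFrame b · y) i ≠ 0 :=
      fun y hy => InnerProductSpace.gramSchmidt_ne_zero i (hf.linearIndependent hy)
    refine ContMDiffOn.inv₀ (fun y hy => ?_) fun y hy => norm_ne_zero_iff.mpr (h0 y hy)
    simp only [norm_eq_sqrt_real_inner]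
    have hsqrt := Real.contDiffAt_sqrt (n := ∞) (inner_self_ne_zero.mpr (h0 y hy))
    exact hsqrt.contMDiffAt.comp_contMDiffWithinAt y (contMDiffOn_inner (hg i) (hg i) y hy)
  choose e he using fun i => exists_vectorField_eventuallyEq hU (hn i)
  refine ⟨e, ?_⟩
  filter_upwards [eventually_all.mpr he, hU] with y hy hyU
  simp only [hy]
  exact InnerProductSpace.gramSchmidtNormed_orthonormal (hf.linearIndependent hyU)

/-- An orthonormal family of the right size, as an orthonormal basis of the tangent space. -/
noncomputable def frameBasis {x : M} {e : Fin (Module.finrank ℝ E) → TangentSpace 𝓘(ℝ, E) x}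
    (he : Orthonormal ℝ e) :
    OrthonormalBasis (Fin (Module.finrank ℝ E)) ℝ (TangentSpace 𝓘(ℝ, E) x) :=
  OrthonormalBasis.mk he (by
    have h : Module.finrank ℝ (TangentSpace 𝓘(ℝ, E) x) = Module.finrank ℝ E := rfl
    rw [he.linearIndependent.span_eq_top_of_card_eq_finrank' (by simp [h])])

omit [IsManifold 𝓘(ℝ, E) ∞ M]
  [IsContMDiffRiemannianBundle 𝓘(ℝ, E) ∞ E fun x : M => TangentSpace 𝓘(ℝ, E) x] in
@[simp] theorem frameBasis_apply {x : M} {e : Fin (Module.finrank ℝ E) → TangentSpace 𝓘(ℝ, E) x}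
    (he : Orthonormal ℝ e) (i) : frameBasis he i = e i := by simp [frameBasis]

theorem contMDiff_of_inner [T2Space M] {s : Π y : M, TangentSpace 𝓘(ℝ, E) y}
    (h : ∀ Z : VF E M, CMDiff ∞ (fun y => inner ℝ (s y) (Z y))) : CMDiff ∞ (T% s) := by
  intro x
  obtain ⟨e, he⟩ := exists_orthonormal_vectorFields (E := E) x
  have h1 : CMDiffAt ∞ (T% (fun y => ∑ i, (inner ℝ (s y) (e i y)) • e i y)) x :=
    ContMDiffAt.sum_section fun i _ => (h (e i) x).smul_section ((e i).contMDiff x)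
  refine h1.congr_of_eventuallyEq ?_
  filter_upwards [he] with y hy
  have := (frameBasis hy).sum_repr' (s y)
  simp only [frameBasis_apply, real_inner_comm] at this
  rw [TotalSpace.mk_inj, this]

end Frames

omit [FiniteDimensional ℝ E] in
theorem contMDiff_mvfderiv_apply {f : M → ℝ} {X : Π y : M, TangentSpace 𝓘(ℝ, E) y}
    (hf : CMDiff ∞ f) (hX : CMDiff ∞ (T% X)) : CMDiff ∞ (fun y => d% f y (X y)) := by
  have h := (hf.contMDiff_tangentMap (m := ∞) (by simp)).comp hX
  exact (contMDiff_snd_tangentBundle_modelSpace ℝ 𝓘(ℝ, ℝ)).comp h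

theorem contMDiff_mlieBracket {X Y : Π y : M, TangentSpace 𝓘(ℝ, E) y}
    (hX : CMDiff ∞ (T% X)) (hY : CMDiff ∞ (T% Y)) :
    CMDiff ∞ (T% (mlieBracket 𝓘(ℝ, E) X Y)) := by
  have := FiniteDimensional.complete ℝ E
  have : IsManifold 𝓘(ℝ, E) (minSmoothness ℝ 2) M := by
    rw [minSmoothness_of_isRCLikeNormedField]; infer_instance
  have : IsManifold 𝓘(ℝ, E) (((⊤ : ℕ∞) : ℕ∞ω) + 1) M := by simpa using! ‹IsManifold 𝓘(ℝ, E) ∞ M›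
  exact ContDiff.mlieBracket_vectorField (m := ⊤) (n := ⊤) hX hY (by simp)

omit [FiniteDimensional ℝ E] [IsManifold 𝓘(ℝ, E) ∞ M] in
theorem SF.mdiffAt (f : SF E M) (x : M) : MDiffAt (f : M → ℝ) x :=
  f.contMDiff.mdifferentiable (by simp) x

namespace VF

omit [FiniteDimensional ℝ E] in
theorem mdiffAt (X : VF E M) (x : M) : MDiffAt (T% (fun y => X y)) x := X.mdifferentiableAt

/-- The derivative of functions along a vector field. -/
noncomputable def deriv (X : VF E M) : SF E M →ₗ[ℝ] SF E M where
  toFun f := ⟨fun y => d% (f : M → ℝ) y (X y), contMDiff_mvfderiv_apply f.contMDiff X.contMDiff⟩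
  map_add' f g := by
    ext y
    change d% ((f : M → ℝ) + (g : M → ℝ)) y (X y) = _
    rw [mvfderiv_add (SF.mdiffAt f y) (SF.mdiffAt g y)]; rfl
  map_smul' c f := by
    ext y
    have h := mvfderiv_mul (f := fun _ : M => c) (g := (f : M → ℝ))
      (I := 𝓘(ℝ, E)) (mdifferentiableAt_const (x := y)) (SF.mdiffAt f y)
    rw [mvfderiv_const, smul_zero, add_zero] at h
    exact congr($h (X y))

omit [FiniteDimensional ℝ E] in
theorem deriv_apply (X : VF E M) (f : SF E M) (x : M) :
    deriv X f x = d% (f : M → ℝ) x (X x) := rfl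

/-- The Lie bracket of smooth vector fields. -/
noncomputable def bracket (X Y : VF E M) : VF E M :=
  ⟨mlieBracket 𝓘(ℝ, E) X Y, contMDiff_mlieBracket X.contMDiff Y.contMDiff⟩

theorem bracket_jacobi (X Y Z : VF E M) :
    bracket X (bracket Y Z) = bracket (bracket X Y) Z + bracket Y (bracket X Z) := by
  have := FiniteDimensional.complete ℝ E
  have : IsManifold 𝓘(ℝ, E) (minSmoothness ℝ 3) M := by
    rw [minSmoothness_of_isRCLikeNormedField]; infer_instance
  have hs : ∀ X : VF E M, CMDiff (minSmoothness ℝ 2) (T% (fun y => X y)) := fun X => by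
    rw [minSmoothness_of_isRCLikeNormedField]
    exact X.contMDiff.of_le ENat.LEInfty.out
  ext x : 1
  exact congrFun (leibniz_identity_mlieBracket (hs X) (hs Y) (hs Z)) x

/-- The product of a function and a vector field. -/
noncomputable def fsmul (f : SF E M) (X : VF E M) : VF E M :=
  ⟨(f : M → ℝ) • (fun y => X y), f.contMDiff.smul_section X.contMDiff⟩

omit [FiniteDimensional ℝ E] in
theorem fsmul_apply (f : SF E M) (X : VF E M) (x : M) : fsmul f X x = f x • X x := rfl

theorem bracket_fsmul (f : SF E M) (X Y : VF E M) :
    bracket X (fsmul f Y) = fsmul (deriv X f) Y + fsmul f (bracket X Y) := by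
  have := FiniteDimensional.complete ℝ E
  ext x : 1
  exact mlieBracket_smul_right (SF.mdiffAt f x) (mdiffAt Y x)

theorem bracket_add (X Y Z : VF E M) : bracket X (Y + Z) = bracket X Y + bracket X Z := by
  have := FiniteDimensional.complete ℝ E
  ext x : 1
  exact mlieBracket_add_right (mdiffAt Y x) (mdiffAt Z x)

theorem fsmul_deriv_bracket (X Y Z : VF E M) (f : SF E M) :
    fsmul (deriv (bracket X Y) f) Z = fsmul (deriv X (deriv Y f) - deriv Y (deriv X f)) Z := by
  have h := bracket_jacobi X Y (fsmul f Z)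
  simp only [bracket_fsmul, bracket_add, bracket_jacobi X Y Z] at h
  ext x : 1
  replace h := congrArg (fun W : VF E M => W x) h
  simp only [ContMDiffSection.coe_add, Pi.add_apply, fsmul_apply] at h
  simp only [fsmul_apply, ContMDiffMap.coe_sub, Pi.sub_apply]
  linear_combination (norm := module) -h

theorem deriv_bracket [T2Space M] (X Y : VF E M) (f : SF E M) :
    deriv (bracket X Y) f = deriv X (deriv Y f) - deriv Y (deriv X f) := by
  ext x
  rcases subsingleton_or_nontrivial (TangentSpace 𝓘(ℝ, E) x) with hx | hx
  · have deriv_apply_eq_zero (W : VF E M) (g : SF E M) : deriv W g x = 0 := by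
      rw [deriv_apply, Subsingleton.elim (W x) 0, map_zero]
    simp only [ContMDiffMap.coe_sub, Pi.sub_apply, deriv_apply_eq_zero, sub_zero]
  · obtain ⟨v, hv⟩ := exists_ne (0 : TangentSpace 𝓘(ℝ, E) x)
    obtain ⟨Z, rfl⟩ := exists_vectorField_apply_eq v
    have h := congrArg (fun W : VF E M => W x) (fsmul_deriv_bracket X Y Z f)
    exact smul_left_injective ℝ hv h

variable [RiemannianBundle (fun x : M => TangentSpace 𝓘(ℝ, E) x)]
  [IsContMDiffRiemannianBundle 𝓘(ℝ, E) ∞ E (fun x : M => TangentSpace 𝓘(ℝ, E) x)]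

/-- The metric, as a form on smooth vector fields. -/
noncomputable def metric : VF E M →ₗ[ℝ] VF E M →ₗ[ℝ] SF E M :=
  LinearMap.mk₂ ℝ (fun X Y => ⟨fun y => inner ℝ (X y) (Y y),
      contMDiffOn_univ.mp (contMDiffOn_inner X.contMDiff.contMDiffOn Y.contMDiff.contMDiffOn)⟩)
    (fun X Y Z => by ext y; exact inner_add_left (X y) (Y y) (Z y))
    (fun c X Y => by ext y; exact real_inner_smul_left (X y) (Y y) c)
    (fun X Y Z => by ext y; exact inner_add_right (X y) (Y y) (Z y))
    (fun c X Y => by ext y; exact real_inner_smul_right (X y) (Y y) c)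

omit [FiniteDimensional ℝ E] in
theorem metric_apply (X Y : VF E M) (x : M) : metric X Y x = inner ℝ (X x) (Y x) := rfl

theorem contMDiff_leviCivita [T2Space M] (X Y : VF E M) :
    CMDiff ∞ (T% (fun y => leviCivita 𝓘(ℝ, E) M Y y (X y))) := by
  refine contMDiff_of_inner fun Z => ?_
  have h : (fun y => inner ℝ (leviCivita 𝓘(ℝ, E) M Y y (X y)) (Z y)) =
      ((1 / 2 : ℝ) • (deriv X (metric Y Z) + deriv Y (metric Z X) - deriv Z (metric X Y)
        + metric (bracket X Y) Z - metric (bracket Y Z) X + metric (bracket Z X) Y) : SF E M) := by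
    ext y
    exact inner_leviCivita 𝓘(ℝ, E) (mdiffAt X y) (mdiffAt Y y) (mdiffAt Z y)
  rw [h]
  exact ContMDiffMap.contMDiff _

/-- The Levi-Civita connection on smooth vector fields. -/
noncomputable def nabla [T2Space M] : VF E M →ₗ[ℝ] VF E M →ₗ[ℝ] VF E M :=
  LinearMap.mk₂ ℝ (fun X Y => ⟨fun y => leviCivita 𝓘(ℝ, E) M Y y (X y), contMDiff_leviCivita X Y⟩)
    (fun X Y Z => by ext y : 1; exact map_add (leviCivita 𝓘(ℝ, E) M Z y) (X y) (Y y))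
    (fun c X Y => by ext y : 1; exact map_smul (leviCivita 𝓘(ℝ, E) M Y y) c (X y))
    (fun X Y Z => by
      ext y : 1
      exact congr($((leviCivita 𝓘(ℝ, E) M).isCovariantDerivativeOnUniv.add
        (mdiffAt Y y) (mdiffAt Z y)) (X y)))
    (fun c X Y => by
      ext y : 1
      exact congr($((leviCivita 𝓘(ℝ, E) M).isCovariantDerivativeOnUniv.smul_const c
        (mdiffAt Y y)) (X y)))

theorem nabla_sub_nabla [T2Space M] (X Y : VF E M) : nabla X Y - nabla Y X = bracket X Y := by
  have := FiniteDimensional.complete ℝ E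
  ext x : 1
  exact (CovariantDerivative.torsion_eq_zero_iff _).mp (leviCivita_torsion 𝓘(ℝ, E))
    (mdiffAt X x) (mdiffAt Y x)

theorem ext_metric [T2Space M] {X Y : VF E M} (h : ∀ Z, metric X Z = metric Y Z) : X = Y := by
  ext x : 1
  refine ext_inner_right ℝ fun v => ?_
  obtain ⟨Z, rfl⟩ := exists_vectorField_apply_eq v
  exact congrArg (fun f : SF E M => f x) (h Z)

variable (E M) in
/-- The calculus of the smooth vector fields and functions on a Riemannian manifold. -/
noncomputable def riemannianCalculus [T2Space M] : RiemannianCalculus (VF E M) (SF E M) where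
  deriv := deriv
  bracket := bracket
  metric := metric
  nabla := nabla
  deriv_bracket := deriv_bracket
  jacobi := bracket_jacobi
  metric_comm X Y := by ext x; exact real_inner_comm (Y x) (X x)
  ext_metric := ext_metric
  deriv_metric X Y Z := by
    ext x
    exact leviCivita_metric 𝓘(ℝ, E) (mdiffAt X x) (mdiffAt Y x) (mdiffAt Z x)
  torsion_free := nabla_sub_nabla

end VF

namespace AlmostHermitian

variable [RiemannianBundle (fun x : M => TangentSpace 𝓘(ℝ, E) x)]
  [IsContMDiffRiemannianBundle 𝓘(ℝ, E) ∞ E (fun x : M => TangentSpace 𝓘(ℝ, E) x)]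
  (𝒥 : AlmostHermitian 𝓘(ℝ, E) M)

/-- The calculus of the smooth vector fields and functions on an almost Hermitian manifold. -/
noncomputable def calculus [T2Space M] : HermitianCalculus (VF E M) (SF E M) where
  toRiemannianCalculus := VF.riemannianCalculus E M
  J :=
    { toFun := fun X => ⟨fun y => 𝒥.J y (X y), ContMDiff.clm_bundle_apply (F₁ := E)
        (E₁ := fun y : M => TangentSpace 𝓘(ℝ, E) y) (F₂ := E)
        (E₂ := fun y : M => TangentSpace 𝓘(ℝ, E) y) (b := fun y => y) 𝒥.contMDiff X.contMDiff⟩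
      map_add' := fun X Y => by ext y : 1; exact map_add (𝒥.J y) (X y) (Y y)
      map_smul' := fun c X => by ext y : 1; exact map_smul (𝒥.J y) c (X y) }
  J_J X := by ext x : 1; exact 𝒥.sq x (X x)
  metric_J_J X Y := by ext x; exact 𝒥.inner_map x (X x) (Y x)

variable [T2Space M]

theorem calculus_nablaJ_apply (X Y : VF E M) (x : M) :
    𝒥.calculus.nablaJ X Y x = 𝒥.nablaJ x (X x) (Y x) :=
  (𝒥.nablaJ_apply (VF.mdiffAt Y x) (X x)).symm

variable {𝒥} in
theorem IsNearlyKahler.calculus (h : 𝒥.IsNearlyKahler) : 𝒥.calculus.IsNearlyKahler := fun X => by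
  ext x : 1
  rw [calculus_nablaJ_apply, h]
  rfl

end AlmostHermitian

end NearlyKahler

/-! ### Curvature at a point -/

namespace NearlyKahler

section CurvatureForms

variable {V : Type*} [AddCommGroup V] [Module ℝ V]

/-- A form with the pair symmetries of a curvature tensor, as a multilinear form: linearity in one
of its arguments is enough. -/
def curvatureLike (F : V → V → V → V → ℝ)
    (hadd : ∀ a b c d f, F a b c (d + f) = F a b c d + F a b c f)
    (hsmul : ∀ a b c (t : ℝ) d, F a b c (t • d) = t • F a b c d)
    (hswap : ∀ a b c d, F a b c d = -F a b d c) (hpair : ∀ a b c d, F a b c d = F c d a b) :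
    V →ₗ[ℝ] V →ₗ[ℝ] V →ₗ[ℝ] V →ₗ[ℝ] ℝ :=
  have add_third (a b c d f) : F a b (c + d) f = F a b c f + F a b d f := by
    rw [hswap, hadd, neg_add, ← hswap, ← hswap]
  have smul_third (a b) (t : ℝ) (c d) : F a b (t • c) d = t • F a b c d := by
    rw [hswap, hsmul, ← smul_neg, ← hswap]
  LinearMap.mk₂ ℝ
    (fun a b => LinearMap.mk₂ ℝ (F a b) (add_third a b) (smul_third a b) (hadd a b)
      fun t c d => hsmul a b c t d)
    (fun a b c => by
      ext u v
      simp only [LinearMap.add_apply, LinearMap.mk₂_apply, hpair _ _ u v, add_third])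
    (fun t a b => by
      ext u v
      simp only [LinearMap.smul_apply, LinearMap.mk₂_apply, hpair _ _ u v, smul_third])
    (fun a b c => by
      ext u v
      simp only [LinearMap.add_apply, LinearMap.mk₂_apply, hpair _ _ u v, hadd])
    (fun t a b => by
      ext u v
      simp only [LinearMap.smul_apply, LinearMap.mk₂_apply, hpair _ _ u v, hsmul])

end CurvatureForms

open Filter Topology

variable {E : Type*} [NormedAddCommGroup E] [NormedSpace ℝ E] [FiniteDimensional ℝ E]
  {M : Type*} [TopologicalSpace M] [ChartedSpace E M] [IsManifold 𝓘(ℝ, E) ∞ M]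
  [RiemannianBundle (fun x : M => TangentSpace 𝓘(ℝ, E) x)]
  [IsContMDiffRiemannianBundle 𝓘(ℝ, E) ∞ E (fun x : M => TangentSpace 𝓘(ℝ, E) x)]

theorem leviCivita_congr {X : VF E M} {Y : Π y : M, TangentSpace 𝓘(ℝ, E) y} {x : M}
    (h : ⇑X =ᶠ[𝓝 x] Y) : leviCivita 𝓘(ℝ, E) M X x = leviCivita 𝓘(ℝ, E) M Y x := by
  refine (leviCivita 𝓘(ℝ, E) M).isCovariantDerivativeOnUniv.congr_of_eventuallyEq
    (VF.mdiffAt X x) ((VF.mdiffAt X x).congr_of_eventuallyEq ?_) univ_mem h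
  filter_upwards [h] with y hy
  rw [hy]

theorem leviCivita_apply_congr {X Y : VF E M} {X' Y' : Π y : M, TangentSpace 𝓘(ℝ, E) y} {x : M}
    (hX : ⇑X =ᶠ[𝓝 x] X') (hY : ⇑Y =ᶠ[𝓝 x] Y') :
    (fun y => leviCivita 𝓘(ℝ, E) M Y y (X y)) =ᶠ[𝓝 x]
      fun y => leviCivita 𝓘(ℝ, E) M Y' y (X' y) := by
  filter_upwards [hX, hY.eventuallyEq_nhds] with y hXy hYy
  rw [leviCivita_congr hYy, hXy]

section Riemannian

variable [T2Space M]

namespace VF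

theorem curvatureForm_nabla_congr {X Y Z W X' Y' Z' W' : VF E M} {x : M} (hX : X x = X' x)
    (hY : Y x = Y' x) (hZ : Z x = Z' x) (hW : W x = W' x) :
    (riemannianCalculus E M).curvatureForm nabla X Y Z W x =
      (riemannianCalculus E M).curvatureForm nabla X' Y' Z' W' x := by
  let K := riemannianCalculus E M
  have last (X Y Z W W' : VF E M) (hW : W x = W' x) :
      K.curvatureForm nabla X Y Z W x = K.curvatureForm nabla X Y Z W' x := by
    change -inner ℝ (K.curvatureOp nabla X Y Z x) (W x) =
      -inner ℝ (K.curvatureOp nabla X Y Z x) (W' x)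
    rw [hW]
  have third (X Y Z W Z' : VF E M) (hZ : Z x = Z' x) :
      K.curvatureForm nabla X Y Z W x = K.curvatureForm nabla X Y Z' W x := by
    have swap (Z : VF E M) := K.curvatureForm_swap_right K.deriv_metric X Y Z W
    exact (congrArg (· x) (swap Z)).trans
      ((congrArg Neg.neg (last X Y W Z Z' hZ)).trans (congrArg (· x) (swap Z')).symm)
  have pair (X Y Z W : VF E M) :
      K.curvatureForm nabla X Y Z W x = K.curvatureForm nabla Z W X Y x :=
    congrArg (· x) (K.curvatureForm_nabla_pair X Y Z W)
  rw [last X Y Z W W' hW, third X Y Z W' Z' hZ, pair, last _ _ _ _ _ hY, third _ _ _ _ _ hX, pair]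

theorem curvature_apply (X Y Z W : VF E M) (x : M) :
    curvature 𝓘(ℝ, E) x (X x) (Y x) (Z x) (W x) =
      (riemannianCalculus E M).curvatureForm nabla X Y Z W x := by
  obtain ⟨X', hX⟩ := exists_vectorField_extend (X x)
  obtain ⟨Y', hY⟩ := exists_vectorField_extend (Y x)
  obtain ⟨Z', hZ⟩ := exists_vectorField_extend (Z x)
  have eX : X x = X' x := by rw [hX.eq_of_nhds, extend_apply_self]
  have eY : Y x = Y' x := by rw [hY.eq_of_nhds, extend_apply_self]
  have eZ : Z x = Z' x := by rw [hZ.eq_of_nhds, extend_apply_self]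
  rw [curvatureForm_nabla_congr eX eY eZ rfl]
  change _ = -inner ℝ ((nabla X' (nabla Y' Z') - nabla Y' (nabla X' Z')
    - nabla (bracket X' Y') Z') x) (W x)
  rw [curvature, curvatureField,
    ← leviCivita_congr (X := nabla Y' Z') (leviCivita_apply_congr hY hZ),
    ← leviCivita_congr (X := nabla X' Z') (leviCivita_apply_congr hX hZ), ← leviCivita_congr hZ,
    ← EventuallyEq.mlieBracket_vectorField_eq (I := 𝓘(ℝ, E)) hX hY, ← hX.eq_of_nhds,
    ← hY.eq_of_nhds]
  rfl

end VF

variable {x : M} (a b c d f : TangentSpace 𝓘(ℝ, E) x)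

theorem curvature_swap_left :
    curvature 𝓘(ℝ, E) x a b c d = -curvature 𝓘(ℝ, E) x b a c d := by
  obtain ⟨A, rfl⟩ := exists_vectorField_apply_eq a
  obtain ⟨B, rfl⟩ := exists_vectorField_apply_eq b
  obtain ⟨C, rfl⟩ := exists_vectorField_apply_eq c
  obtain ⟨D, rfl⟩ := exists_vectorField_apply_eq d
  simp only [VF.curvature_apply]
  exact congrArg (· x) ((VF.riemannianCalculus E M).curvatureForm_swap_left VF.nabla A B C D)

theorem curvature_pair :
    curvature 𝓘(ℝ, E) x a b c d = curvature 𝓘(ℝ, E) x c d a b := by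
  obtain ⟨A, rfl⟩ := exists_vectorField_apply_eq a
  obtain ⟨B, rfl⟩ := exists_vectorField_apply_eq b
  obtain ⟨C, rfl⟩ := exists_vectorField_apply_eq c
  obtain ⟨D, rfl⟩ := exists_vectorField_apply_eq d
  simp only [VF.curvature_apply]
  exact congrArg (· x) ((VF.riemannianCalculus E M).curvatureForm_nabla_pair A B C D)

theorem curvature_swap_right :
    curvature 𝓘(ℝ, E) x a b c d = -curvature 𝓘(ℝ, E) x a b d c := by
  rw [curvature_pair, curvature_swap_left, curvature_pair]

theorem curvature_bianchi : curvature 𝓘(ℝ, E) x a b c d + curvature 𝓘(ℝ, E) x b c a d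
    + curvature 𝓘(ℝ, E) x c a b d = 0 := by
  obtain ⟨A, rfl⟩ := exists_vectorField_apply_eq a
  obtain ⟨B, rfl⟩ := exists_vectorField_apply_eq b
  obtain ⟨C, rfl⟩ := exists_vectorField_apply_eq c
  obtain ⟨D, rfl⟩ := exists_vectorField_apply_eq d
  simp only [VF.curvature_apply]
  exact congrArg (· x) ((VF.riemannianCalculus E M).curvatureForm_nabla_bianchi A B C D)

omit [T2Space M] in
theorem curvature_add_right :
    curvature 𝓘(ℝ, E) x a b c (d + f) =
      curvature 𝓘(ℝ, E) x a b c d + curvature 𝓘(ℝ, E) x a b c f := by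
  simp only [curvature, inner_add_right, neg_add]

omit [T2Space M] in
theorem curvature_smul_right (t : ℝ) :
    curvature 𝓘(ℝ, E) x a b c (t • d) = t • curvature 𝓘(ℝ, E) x a b c d := by
  simp only [curvature, inner_smul_right, smul_eq_mul, mul_neg]

end Riemannian

namespace AlmostHermitian

variable (𝒥 : AlmostHermitian 𝓘(ℝ, E) M) {x : M} (a b c d f : TangentSpace 𝓘(ℝ, E) x)

omit [FiniteDimensional ℝ E]
  [IsContMDiffRiemannianBundle 𝓘(ℝ, E) ∞ E (fun x : M => TangentSpace 𝓘(ℝ, E) x)] in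
theorem inner_J_left : inner ℝ (𝒥.J x a) b = inner ℝ a (-𝒥.J x b) := by
  rw [← 𝒥.inner_map x a, map_neg, 𝒥.sq, neg_neg]

theorem nablaJ_J [T2Space M] : 𝒥.nablaJ x a (𝒥.J x b) = -𝒥.J x (𝒥.nablaJ x a b) := by
  obtain ⟨A, rfl⟩ := exists_vectorField_apply_eq a
  obtain ⟨B, rfl⟩ := exists_vectorField_apply_eq b
  rw [← 𝒥.calculus_nablaJ_apply A B]
  exact (𝒥.calculus_nablaJ_apply A (𝒥.calculus.J B) x).symm.trans
    (congrArg (fun X : VF E M => X x) (𝒥.calculus.nablaJ_J_right A B))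

theorem inner_nablaJ [T2Space M] :
    inner ℝ (𝒥.nablaJ x a b) c = -inner ℝ b (𝒥.nablaJ x a c) := by
  obtain ⟨A, rfl⟩ := exists_vectorField_apply_eq a
  obtain ⟨B, rfl⟩ := exists_vectorField_apply_eq b
  obtain ⟨C, rfl⟩ := exists_vectorField_apply_eq c
  rw [← 𝒥.calculus_nablaJ_apply A B, ← 𝒥.calculus_nablaJ_apply A C]
  exact congrArg (· x) (𝒥.calculus.metric_nablaJ_left A B C)

theorem starRicci_eq_sum [T2Space M] : 𝒥.starRicci x a b =
    ∑ k, curvature 𝓘(ℝ, E) x a (stdOrthonormalBasis ℝ (TangentSpace 𝓘(ℝ, E) x) k) (𝒥.J x b)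
      (𝒥.J x (stdOrthonormalBasis ℝ (TangentSpace 𝓘(ℝ, E) x) k)) := by
  rw [starRicci]
  set e := stdOrthonormalBasis ℝ (TangentSpace 𝓘(ℝ, E) x)
  let R := curvatureLike (curvature 𝓘(ℝ, E) x) curvature_add_right
    (fun a b c t d => curvature_smul_right a b c d t) curvature_swap_right curvature_pair
  have adjoint : ∑ k, curvature 𝓘(ℝ, E) x a (e k) (𝒥.J x b) (𝒥.J x (e k)) =
      -∑ k, curvature 𝓘(ℝ, E) x (𝒥.J x b) (e k) a (𝒥.J x (e k)) := by
    have h := sum_apply_adjoint e ((R a).flip (𝒥.J x b)).flip 𝒥.inner_J_left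
    simp only [LinearMap.flip_apply, map_neg, Finset.sum_neg_distrib] at h
    refine h.trans (congrArg Neg.neg (Finset.sum_congr rfl fun k _ => ?_))
    exact curvature_pair _ _ _ _
  have bianchi (k) : curvature 𝓘(ℝ, E) x a (𝒥.J x b) (e k) (𝒥.J x (e k)) =
      curvature 𝓘(ℝ, E) x a (e k) (𝒥.J x b) (𝒥.J x (e k))
        - curvature 𝓘(ℝ, E) x (𝒥.J x b) (e k) a (𝒥.J x (e k)) := by
    have h := curvature_bianchi a (𝒥.J x b) (e k) (𝒥.J x (e k))
    rw [curvature_swap_left (e k) a] at h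
    linarith
  simp only [bianchi, Finset.sum_sub_distrib]
  linarith

/-- The curvature form of the canonical connection, for a nearly Kähler `𝒥`. -/
noncomputable def canonicalCurvature (a b c d : TangentSpace 𝓘(ℝ, E) x) : ℝ :=
  curvature 𝓘(ℝ, E) x a b c d
    - 1 / 2 * inner ℝ (𝒥.nablaJ x a b) (𝒥.nablaJ x c d)
    + 1 / 4 * (inner ℝ (𝒥.nablaJ x a c) (𝒥.nablaJ x b d)
      - inner ℝ (𝒥.nablaJ x b c) (𝒥.nablaJ x a d))

theorem canonicalCurvature_add_right :
    𝒥.canonicalCurvature a b c (d + f) =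
      𝒥.canonicalCurvature a b c d + 𝒥.canonicalCurvature a b c f := by
  simp only [canonicalCurvature, curvature_add_right, map_add, inner_add_right]
  ring

theorem canonicalCurvature_smul_right (t : ℝ) :
    𝒥.canonicalCurvature a b c (t • d) = t • 𝒥.canonicalCurvature a b c d := by
  simp only [canonicalCurvature, curvature_smul_right, map_smul, inner_smul_right, smul_eq_mul]
  ring

namespace IsNearlyKahler

variable {𝒥} (h : 𝒥.IsNearlyKahler)
include h

theorem nablaJ_swap : 𝒥.nablaJ x a b = -𝒥.nablaJ x b a := by
  have h' := h x (a + b)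
  simp only [map_add, add_apply, h x, zero_add, add_zero] at h'
  exact eq_neg_of_add_eq_zero_right h'

variable [T2Space M]

theorem curvature_sub_curvature_J_J :
    curvature 𝓘(ℝ, E) x a b c d - curvature 𝓘(ℝ, E) x a b (𝒥.J x c) (𝒥.J x d) =
      inner ℝ (𝒥.nablaJ x a b) (𝒥.nablaJ x c d) := by
  obtain ⟨A, rfl⟩ := exists_vectorField_apply_eq a
  obtain ⟨B, rfl⟩ := exists_vectorField_apply_eq b
  obtain ⟨C, rfl⟩ := exists_vectorField_apply_eq c
  obtain ⟨D, rfl⟩ := exists_vectorField_apply_eq d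
  rw [← 𝒥.calculus_nablaJ_apply A B, ← 𝒥.calculus_nablaJ_apply C D, VF.curvature_apply]
  change _ - curvature 𝓘(ℝ, E) x (A x) (B x) (𝒥.calculus.J C x) (𝒥.calculus.J D x) = _
  rw [VF.curvature_apply]
  exact congrArg (· x) (h.calculus.curvatureForm_nabla_sub_J_J A B C D)

theorem canonicalCurvature_apply (A B C D : VF E M) (x : M) :
    𝒥.canonicalCurvature (A x) (B x) (C x) (D x) =
      𝒥.calculus.curvatureForm 𝒥.calculus.canonicalConnection A B C D x := by
  rw [h.calculus.curvatureForm_canonicalConnection_eq, canonicalCurvature, VF.curvature_apply]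
  simp only [← 𝒥.calculus_nablaJ_apply]
  rfl

theorem canonicalCurvature_pair :
    𝒥.canonicalCurvature a b c d = 𝒥.canonicalCurvature c d a b := by
  simp only [canonicalCurvature]
  rw [curvature_pair, real_inner_comm (𝒥.nablaJ x c d), h.nablaJ_swap a c,
    h.nablaJ_swap b d, h.nablaJ_swap b c, h.nablaJ_swap a d,
    real_inner_comm (-𝒥.nablaJ x d a)]
  simp only [inner_neg_neg]

theorem canonicalCurvature_swap_right :
    𝒥.canonicalCurvature a b c d = -𝒥.canonicalCurvature a b d c := by
  simp only [canonicalCurvature]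
  rw [curvature_swap_right, h.nablaJ_swap c d, inner_neg_right,
    real_inner_comm (𝒥.nablaJ x b d), real_inner_comm (𝒥.nablaJ x b c)]
  ring

theorem canonicalCurvature_bianchi :
    𝒥.canonicalCurvature a b c d + 𝒥.canonicalCurvature b c a d + 𝒥.canonicalCurvature c a b d =
      -(inner ℝ (𝒥.nablaJ x a b) (𝒥.nablaJ x c d) + inner ℝ (𝒥.nablaJ x b c) (𝒥.nablaJ x a d)
        + inner ℝ (𝒥.nablaJ x c a) (𝒥.nablaJ x b d)) := by
  have h1 := curvature_bianchi a b c d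
  simp only [canonicalCurvature]
  rw [h.nablaJ_swap a c, h.nablaJ_swap b a, h.nablaJ_swap c b]
  simp only [inner_neg_left]
  linarith

theorem canonicalCurvature_nablaJ :
    𝒥.canonicalCurvature a b (𝒥.nablaJ x c d) f =
      𝒥.canonicalCurvature a b c (𝒥.nablaJ x d f)
        - 𝒥.canonicalCurvature a b d (𝒥.nablaJ x c f) := by
  obtain ⟨A, rfl⟩ := exists_vectorField_apply_eq a
  obtain ⟨B, rfl⟩ := exists_vectorField_apply_eq b
  obtain ⟨C, rfl⟩ := exists_vectorField_apply_eq c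
  obtain ⟨D, rfl⟩ := exists_vectorField_apply_eq d
  obtain ⟨F, rfl⟩ := exists_vectorField_apply_eq f
  simp only [← 𝒥.calculus_nablaJ_apply, h.canonicalCurvature_apply]
  exact congrArg (· x) (h.calculus.curvatureForm_canonicalConnection_nablaJ A B C D F)

theorem canonicalCurvature_J_J :
    𝒥.canonicalCurvature a b (𝒥.J x c) (𝒥.J x d) = 𝒥.canonicalCurvature a b c d := by
  obtain ⟨A, rfl⟩ := exists_vectorField_apply_eq a
  obtain ⟨B, rfl⟩ := exists_vectorField_apply_eq b
  obtain ⟨C, rfl⟩ := exists_vectorField_apply_eq c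
  obtain ⟨D, rfl⟩ := exists_vectorField_apply_eq d
  change 𝒥.canonicalCurvature (A x) (B x) (𝒥.calculus.J C x) (𝒥.calculus.J D x) = _
  simp only [h.canonicalCurvature_apply]
  exact congrArg (· x) (𝒥.calculus.curvatureForm_canonicalConnection_J_J A B C D)

/-- The tensors of a nearly Kähler manifold at the point `x`. -/
noncomputable def tangentModel (x : M) : TangentModel (TangentSpace 𝓘(ℝ, E) x) where
  J := 𝒥.J x
  nablaJ := (𝒥.nablaJ x).toLinearMap₁₂
  curv := curvatureLike 𝒥.canonicalCurvature 𝒥.canonicalCurvature_add_right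
    (fun a b c t d => 𝒥.canonicalCurvature_smul_right a b c d t) h.canonicalCurvature_swap_right
    h.canonicalCurvature_pair
  J_J := 𝒥.sq x
  inner_J_J := 𝒥.inner_map x
  nablaJ_swap := h.nablaJ_swap
  nablaJ_J u v := 𝒥.nablaJ_J u v
  inner_nablaJ u v w := 𝒥.inner_nablaJ u v w
  curv_swap_right := h.canonicalCurvature_swap_right
  curv_pair := h.canonicalCurvature_pair
  curv_bianchi := h.canonicalCurvature_bianchi
  curv_nablaJ := h.canonicalCurvature_nablaJ
  curv_J_J := h.canonicalCurvature_J_J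

theorem ricci_eq_tangentModel_ricci_add : ricci 𝓘(ℝ, E) x a b =
    (h.tangentModel x).ricci (stdOrthonormalBasis ℝ (TangentSpace 𝓘(ℝ, E) x)) a b
      + 1 / 4 * inner ℝ (𝒥.r x a) b := by
  rw [inner_r, Finset.mul_sum, TangentModel.ricci, ← Finset.sum_add_distrib]
  refine Finset.sum_congr rfl fun k _ => ?_
  change _ = 𝒥.canonicalCurvature _ _ _ _ + _
  generalize stdOrthonormalBasis ℝ (TangentSpace 𝓘(ℝ, E) x) k = e
  rw [canonicalCurvature, h x, inner_zero_right, h.nablaJ_swap a e, h.nablaJ_swap b e,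
    real_inner_comm (-𝒥.nablaJ x e a)]
  simp only [inner_neg_left, inner_neg_right]
  ring

theorem inner_r_eq_ricci_sub_starRicci :
    inner ℝ (𝒥.r x a) b = ricci 𝓘(ℝ, E) x a b - 𝒥.starRicci x a b := by
  rw [starRicci_eq_sum, ricci, ← Finset.sum_sub_distrib, inner_r]
  refine Finset.sum_congr rfl fun k _ => ?_
  rw [h.curvature_sub_curvature_J_J, h.nablaJ_swap a, h.nablaJ_swap b, inner_neg_neg]

end IsNearlyKahler
end AlmostHermitian
end NearlyKahler

/-! ### Eigenspaces of `r` -/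

namespace NearlyKahler.AlmostHermitian

variable {E : Type*} [NormedAddCommGroup E] [NormedSpace ℝ E] [FiniteDimensional ℝ E]
  {M : Type*} [TopologicalSpace M] [ChartedSpace E M] [IsManifold 𝓘(ℝ, E) ∞ M]
  [RiemannianBundle (fun x : M => TangentSpace 𝓘(ℝ, E) x)]
  [IsContMDiffRiemannianBundle 𝓘(ℝ, E) ∞ E (fun x : M => TangentSpace 𝓘(ℝ, E) x)]
  (𝒥 : AlmostHermitian 𝓘(ℝ, E) M)

theorem isSymmetric_r (x : M) :
    (𝒥.r x : TangentSpace 𝓘(ℝ, E) x →ₗ[ℝ] TangentSpace 𝓘(ℝ, E) x).IsSymmetric := fun u v => by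
  simp only [ContinuousLinearMap.coe_coe]
  rw [real_inner_comm (𝒥.r x v), inner_r, inner_r]
  exact Finset.sum_congr rfl fun k _ => real_inner_comm _ _

variable {𝒥} {x : M} {c d : ℝ} {u v : TangentSpace 𝓘(ℝ, E) x}

theorem mem_eigenspace_iff : u ∈ 𝒥.eigenspace x c ↔ 𝒥.r x u = c • u :=
  Module.End.mem_eigenspace_iff

theorem orthogonalFamily_eigenspace (x : M) {ι : Type*} {lam : ι → ℝ}
    (hlam : Function.Injective lam) :
    OrthogonalFamily ℝ (fun i => 𝒥.eigenspace x (lam i))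
      fun i => (𝒥.eigenspace x (lam i)).subtypeₗᵢ :=
  (𝒥.isSymmetric_r x).orthogonalFamily_eigenspaces.comp hlam

theorem isInternal_eigenspace {ι : Type*} [DecidableEq ι] {lam : ι → ℝ}
    (hlam : Function.Injective lam) (h : ∀ c, 𝒥.eigenspace x c ≠ ⊥ → ∃ i, lam i = c) :
    DirectSum.IsInternal (fun i => 𝒥.eigenspace x (lam i)) := by
  rw [(orthogonalFamily_eigenspace x hlam).isInternal_iff, eq_bot_iff,
    ← (𝒥.isSymmetric_r x).orthogonalComplement_iSup_eigenspaces_eq_bot]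
  refine Submodule.orthogonal_le (iSup_le fun c => ?_)
  by_cases hc : 𝒥.eigenspace x c = ⊥
  · exact hc.le.trans bot_le
  · obtain ⟨i, rfl⟩ := h c hc
    exact le_iSup (fun i => 𝒥.eigenspace x (lam i)) i

variable (𝒥) in
theorem exists_eigenvalues (x : M) : ∃ (p : ℕ) (lam : Fin p → ℝ), Function.Injective lam ∧
    ∀ c, 𝒥.eigenspace x c ≠ ⊥ ↔ ∃ i, lam i = c := by
  have hfin : {c : ℝ | 𝒥.eigenspace x c ≠ ⊥}.Finite :=
    Module.End.finite_hasEigenvalue (𝒥.r x : Module.End ℝ (TangentSpace 𝓘(ℝ, E) x))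
  let e := hfin.toFinset.equivFin.symm
  refine ⟨_, fun i => e i, Subtype.val_injective.comp e.injective, fun c => ⟨fun hc => ?_, ?_⟩⟩
  · exact ⟨e.symm ⟨c, hfin.mem_toFinset.mpr hc⟩, by simp⟩
  · rintro ⟨i, rfl⟩
    exact hfin.mem_toFinset.mp (e i).2

section Parts

variable [T2Space M]

theorem inner_rPart_eq_sum (W : Submodule ℝ (TangentSpace 𝓘(ℝ, E) x)) :
    inner ℝ (𝒥.rPart x W u) v = ∑ k, inner ℝ
      (𝒥.nablaJ x u (stdOrthonormalBasis ℝ W k : TangentSpace 𝓘(ℝ, E) x))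
      (𝒥.nablaJ x v (stdOrthonormalBasis ℝ W k : TangentSpace 𝓘(ℝ, E) x)) := by
  rw [inner_rPart, traceOn, ← Finset.sum_neg_distrib]
  refine Finset.sum_congr rfl fun k _ => ?_
  rw [ContinuousLinearMap.comp_apply, 𝒥.inner_nablaJ, neg_neg, real_inner_comm]

theorem sum_inner_nablaJ_r {ι : Type*} [Fintype ι] [DecidableEq ι] {lam : ι → ℝ}
    (hlam : Function.Injective lam)
    (hint : DirectSum.IsInternal (fun i => 𝒥.eigenspace x (lam i)))
    {κ : Type*} [Fintype κ] (e : OrthonormalBasis κ ℝ (TangentSpace 𝓘(ℝ, E) x)) :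
    ∑ k, inner ℝ (𝒥.nablaJ x u (e k)) (𝒥.nablaJ x v (𝒥.r x (e k))) =
      ∑ s, lam s * inner ℝ (𝒥.rPart x (𝒥.eigenspace x (lam s)) u) v := by
  let f := hint.collectedOrthonormalBasis (orthogonalFamily_eigenspace x hlam)
    fun s => stdOrthonormalBasis ℝ (𝒥.eigenspace x (lam s))
  have f_apply (s k) : f ⟨s, k⟩ =
      (stdOrthonormalBasis ℝ (𝒥.eigenspace x (lam s)) k : TangentSpace 𝓘(ℝ, E) x) := by
    simp [f, DirectSum.IsInternal.collectedOrthonormalBasis]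
  have change_basis := sum_apply_self_eq e f ((innerₗ (TangentSpace 𝓘(ℝ, E) x)).compl₁₂
    (𝒥.nablaJ x u).toLinearMap ((𝒥.nablaJ x v).toLinearMap ∘ₗ (𝒥.r x).toLinearMap))
  simp only [LinearMap.compl₁₂_apply, LinearMap.comp_apply, ContinuousLinearMap.coe_coe,
    innerₗ_apply_apply] at change_basis
  rw [change_basis, Fintype.sum_sigma]
  refine Finset.sum_congr rfl fun s _ => ?_
  rw [inner_rPart_eq_sum, Finset.mul_sum]
  refine Finset.sum_congr rfl fun k _ => ?_
  rw [f_apply, mem_eigenspace_iff.mp (stdOrthonormalBasis ℝ (𝒥.eigenspace x (lam s)) k).2,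
    map_smul, inner_smul_right]

end Parts

namespace IsNearlyKahler

variable (h : 𝒥.IsNearlyKahler)
include h

theorem ricci_eq_zero_of_mem_eigenspace [T2Space M] (hcd : c ≠ d)
    (hu : u ∈ 𝒥.eigenspace x c) (hv : v ∈ 𝒥.eigenspace x d) : ricci 𝓘(ℝ, E) x u v = 0 := by
  have orthogonal : inner ℝ u v = 0 :=
    (𝒥.isSymmetric_r x).orthogonalFamily_eigenspaces hcd ⟨u, hu⟩ ⟨v, hv⟩
  rw [mem_eigenspace_iff] at hu hv
  rw [h.ricci_eq_tangentModel_ricci_add, (h.tangentModel x).ricci_eq_zero_of_eigenvectors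
    (r := (𝒥.r x).toLinearMap) _ (𝒥.inner_r x) hcd hu hv, hu, real_inner_smul_left, orthogonal]
  ring

theorem ricci_eq_of_mem_eigenspace [T2Space M] {ι : Type*} [Fintype ι] [DecidableEq ι]
    {lam : ι → ℝ} (hlam : Function.Injective lam)
    (hint : DirectSum.IsInternal (fun i => 𝒥.eigenspace x (lam i))) (hc : c ≠ 0)
    (hu : u ∈ 𝒥.eigenspace x c) (hv : v ∈ 𝒥.eigenspace x c) :
    ricci 𝓘(ℝ, E) x u v = c / 4 * inner ℝ u v +
      1 / c * ∑ s, lam s * inner ℝ (𝒥.rPart x (𝒥.eigenspace x (lam s)) u) v := by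
  rw [mem_eigenspace_iff] at hu hv
  rw [h.ricci_eq_tangentModel_ricci_add, (h.tangentModel x).ricci_eq_of_eigenvector
    (r := (𝒥.r x).toLinearMap) _ (𝒥.inner_r x) hc hv, hu, real_inner_smul_left,
    ← sum_inner_nablaJ_r hlam hint (stdOrthonormalBasis ℝ _)]
  change 1 / c * ∑ i, inner ℝ (𝒥.nablaJ x u _) (𝒥.nablaJ x v (𝒥.r x _)) + _ = _
  ring

theorem inner_r_self_pos (hs : 𝒥.IsStrict) (hu : u ≠ 0) : 0 < inner ℝ (𝒥.r x u) u := by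
  rw [inner_r]
  refine (Finset.sum_nonneg fun k _ => real_inner_self_nonneg).lt_of_ne' fun h0 => hs x u hu ?_
  rw [Finset.sum_eq_zero_iff_of_nonneg fun k _ => real_inner_self_nonneg] at h0
  apply ContinuousLinearMap.coe_injective
  refine (stdOrthonormalBasis ℝ (TangentSpace 𝓘(ℝ, E) x)).toBasis.ext fun k => ?_
  have hk := inner_self_eq_zero.mp (h0 k (Finset.mem_univ k))
  simp [h.nablaJ_swap u, hk]

theorem pos_of_eigenspace_ne_bot (hs : 𝒥.IsStrict) (hc : 𝒥.eigenspace x c ≠ ⊥) : 0 < c := by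
  obtain ⟨u, hu, hu0⟩ := Submodule.exists_mem_ne_zero_of_ne_bot hc
  have hpos := h.inner_r_self_pos hs hu0
  rw [mem_eigenspace_iff.mp hu, real_inner_smul_left] at hpos
  exact pos_of_mul_pos_left hpos real_inner_self_nonneg

end IsNearlyKahler
end NearlyKahler.AlmostHermitian

/-! ### The tensor `r` is parallel -/

namespace NearlyKahler

open Filter Topology

section LocallyConstant

variable {E : Type*} [NormedAddCommGroup E] [NormedSpace ℝ E]
  {M : Type*} [TopologicalSpace M] [ChartedSpace E M] [IsManifold 𝓘(ℝ, E) ∞ M]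

theorem hasFDerivAt_comp_chartAt_symm {f : M → ℝ} (hf : MDiff f) (h0 : ∀ x : M, d% f x = 0)
    (x : M) {z : E} (hz : z ∈ (chartAt E x).target) :
    HasFDerivAt (f ∘ (chartAt E x).symm) (0 : E →L[ℝ] ℝ) z := by
  have : IsManifold 𝓘(ℝ, E) 1 M := IsManifold.of_le (n := ∞) (by simp)
  have hchart : MDiffAt (chartAt E x).symm z :=
    mdifferentiableAt_atlas_symm (chart_mem_atlas E x) hz
  have hcomp : HasMFDerivAt 𝓘(ℝ, E) 𝓘(ℝ, ℝ) (f ∘ (chartAt E x).symm) z _ :=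
    (hf ((chartAt E x).symm z)).hasMFDerivAt.comp z hchart.hasMFDerivAt
  have hzero : mfderiv 𝓘(ℝ, E) 𝓘(ℝ, ℝ) f ((chartAt E x).symm z) = 0 := by
    ext v
    exact congr($(h0 ((chartAt E x).symm z)) v)
  rw [hzero, ContinuousLinearMap.zero_comp] at hcomp
  exact hcomp.hasFDerivAt

theorem isLocallyConstant_of_mvfderiv_eq_zero {f : M → ℝ} (hf : MDiff f)
    (h0 : ∀ x : M, d% f x = 0) : IsLocallyConstant f := by
  rw [IsLocallyConstant.iff_eventually_eq]
  intro x
  let φ := chartAt E x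
  have hx : x ∈ φ.source := mem_chart_source E x
  have hd (z) (hz : z ∈ φ.target) := hasFDerivAt_comp_chartAt_symm hf h0 x hz
  obtain ⟨ε, hε, hball⟩ := Metric.isOpen_iff.mp φ.open_target _ (φ.map_source hx)
  filter_upwards [φ.open_source.mem_nhds hx, φ.continuousAt hx (Metric.ball_mem_nhds _ hε)]
    with y hy hyball
  have := (convex_ball (φ x) ε).is_const_of_fderivWithin_eq_zero (𝕜 := ℝ) (f := f ∘ φ.symm)
    (fun z hz => (hd z (hball hz)).differentiableAt.differentiableWithinAt)
    (fun z hz => (hd z (hball hz)).hasFDerivWithinAt.fderivWithin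
      (Metric.isOpen_ball.uniqueDiffWithinAt hz)) hyball (Metric.mem_ball_self hε)
  simpa [φ.left_inv hy, φ.left_inv hx] using this

end LocallyConstant

variable {E : Type*} [NormedAddCommGroup E] [NormedSpace ℝ E] [FiniteDimensional ℝ E]
  {M : Type*} [TopologicalSpace M] [T2Space M] [ChartedSpace E M] [IsManifold 𝓘(ℝ, E) ∞ M]
  [RiemannianBundle (fun x : M => TangentSpace 𝓘(ℝ, E) x)]
  [IsContMDiffRiemannianBundle 𝓘(ℝ, E) ∞ E (fun x : M => TangentSpace 𝓘(ℝ, E) x)]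

omit [FiniteDimensional ℝ E] [T2Space M] [IsManifold 𝓘(ℝ, E) ∞ M]
  [RiemannianBundle (fun x : M => TangentSpace 𝓘(ℝ, E) x)]
  [IsContMDiffRiemannianBundle 𝓘(ℝ, E) ∞ E (fun x : M => TangentSpace 𝓘(ℝ, E) x)] in
theorem SF.sum_apply {ι : Type*} (s : Finset ι) (f : ι → SF E M) (x : M) :
    (∑ i ∈ s, f i) x = ∑ i ∈ s, f i x :=
  map_sum (ContMDiffMap.evalRingHom x) f s

namespace VF

omit [FiniteDimensional ℝ E] [T2Space M]
  [RiemannianBundle (fun x : M => TangentSpace 𝓘(ℝ, E) x)]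
  [IsContMDiffRiemannianBundle 𝓘(ℝ, E) ∞ E (fun x : M => TangentSpace 𝓘(ℝ, E) x)] in
theorem deriv_congr {f g : SF E M} {x : M} (h : ⇑f =ᶠ[𝓝 x] g) (X : VF E M) :
    deriv X f x = deriv X g x := by
  change d% (f : M → ℝ) x (X x) = d% (g : M → ℝ) x (X x)
  have := h.mfderiv_eq (I := 𝓘(ℝ, E)) (I' := 𝓘(ℝ, ℝ))
  exact congr($this (X x))

omit [FiniteDimensional ℝ E] [T2Space M]
  [RiemannianBundle (fun x : M => TangentSpace 𝓘(ℝ, E) x)]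
  [IsContMDiffRiemannianBundle 𝓘(ℝ, E) ∞ E (fun x : M => TangentSpace 𝓘(ℝ, E) x)] in
theorem deriv_eq_zero_of_eventuallyEq_const {f : SF E M} {x : M} {c : ℝ}
    (h : ∀ᶠ y in 𝓝 x, f y = c) (X : VF E M) : deriv X f x = 0 := by
  rw [deriv_congr (g := ContMDiffMap.const c) h]
  change d% (fun _ : M => c) x (X x) = 0
  rw [mvfderiv_const]
  rfl

section MetricDerivation

variable {W : VF E M} {D : VF E M → VF E M}
  (hD : ∀ X Y, deriv W (metric X Y) = metric (D X) Y + metric X (D Y))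
  {e : Fin (Module.finrank ℝ E) → VF E M} {x : M}
  (he : ∀ᶠ y in 𝓝 x, Orthonormal ℝ (fun i => e i y))
include hD he

omit [FiniteDimensional ℝ E] [T2Space M] in
theorem inner_frame_skew (i j : Fin (Module.finrank ℝ E)) :
    inner ℝ (D (e i) x) (e j x) = -inner ℝ (e i x) (D (e j) x) := by
  have leibniz : deriv W (metric (e i) (e j)) x =
      inner ℝ (D (e i) x) (e j x) + inner ℝ (e i x) (D (e j) x) :=
    congrArg (fun f : SF E M => f x) (hD (e i) (e j))
  rw [deriv_eq_zero_of_eventuallyEq_const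
    (he.mono fun y hy => orthonormal_iff_ite.mp hy i j)] at leibniz
  linarith

omit [T2Space M] in
theorem sum_apply_frame_add (F : TangentSpace 𝓘(ℝ, E) x →ₗ[ℝ] TangentSpace 𝓘(ℝ, E) x →ₗ[ℝ] ℝ) :
    ∑ i, F (D (e i) x) (e i x) + ∑ i, F (e i x) (D (e i) x) = 0 := by
  have h := sum_apply_eq_of_inner_eq (frameBasis he.self_of_nhds) F
    (t := fun i => D (e i) x) (s := fun i => -D (e i) x)
    (by simpa only [frameBasis_apply, inner_neg_right] using inner_frame_skew hD he)
  simp only [frameBasis_apply, map_neg, Finset.sum_neg_distrib] at h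
  rw [h, neg_add_cancel]

end MetricDerivation

section Trace

variable {A B : Module.End ℝ (VF E M)} {a b : Π x : M, Module.End ℝ (TangentSpace 𝓘(ℝ, E) x)}
  (hA : ∀ X x, A X x = a x (X x)) (hB : ∀ X x, B X x = b x (X x))
include hA

omit [T2Space M] in
theorem trace_eq_sum_metric {e : Fin (Module.finrank ℝ E) → VF E M} {x : M}
    (he : Orthonormal ℝ (fun i => e i x)) :
    LinearMap.trace ℝ _ (a x) = (∑ k, metric (e k) (A (e k)) : SF E M) x := by
  rw [LinearMap.trace_eq_sum_inner _ (frameBasis he), SF.sum_apply]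
  refine Finset.sum_congr rfl fun k _ => ?_
  rw [metric_apply, hA, frameBasis_apply]

theorem contMDiff_trace : CMDiff ∞ (fun x => LinearMap.trace ℝ _ (a x)) := fun x => by
  obtain ⟨e, he⟩ := exists_orthonormal_vectorFields (E := E) x
  exact ((∑ k, metric (e k) (A (e k)) : SF E M).contMDiff x).congr_of_eventuallyEq
    (he.mono fun y hy => trace_eq_sum_metric hA hy)

omit hA in
/-- The trace of the field of endomorphisms `a`, as a smooth function; `a` is smooth because it
carries smooth vector fields to smooth vector fields. -/
noncomputable def trace (hA : ∀ X x, A X x = a x (X x)) : SF E M := ⟨_, contMDiff_trace hA⟩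

include hB in
theorem deriv_trace {W : VF E M} {D : VF E M → VF E M}
    (hD : ∀ X Y, deriv W (metric X Y) = metric (D X) Y + metric X (D Y))
    (hDA : ∀ X, D (A X) = A (D X) + B X) : deriv W (trace hA) = trace hB := by
  ext x
  obtain ⟨e, he⟩ := exists_orthonormal_vectorFields (E := E) x
  have skew := sum_apply_frame_add hD he ((innerₗ (TangentSpace 𝓘(ℝ, E) x)).compl₂ (a x))
  simp only [LinearMap.compl₂_apply, innerₗ_apply_apply, ← hA, ← metric_apply] at skew
  rw [deriv_congr (he.mono fun y hy => trace_eq_sum_metric hA hy), map_sum, SF.sum_apply]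
  refine Eq.trans ?_ (trace_eq_sum_metric hB he.self_of_nhds).symm
  rw [SF.sum_apply]
  simp only [hD, hDA, map_add, ContMDiffMap.coe_add, Pi.add_apply, Finset.sum_add_distrib]
  linarith

end Trace

end VF

namespace AlmostHermitian

variable (𝒥 : AlmostHermitian 𝓘(ℝ, E) M)

theorem calculus_nablaJ_mul_apply (X Y Z : VF E M) (x : M) :
    (𝒥.calculus.nablaJ X * 𝒥.calculus.nablaJ Y : Module.End ℝ (VF E M)) Z x =
      ((𝒥.nablaJ x (X x)).toLinearMap * (𝒥.nablaJ x (Y x)).toLinearMap :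
        Module.End ℝ (TangentSpace 𝓘(ℝ, E) x)) (Z x) := by
  rw [Module.End.mul_apply, 𝒥.calculus_nablaJ_apply, 𝒥.calculus_nablaJ_apply]
  rfl

/-- The function `Tr ((∇_X J) (∇_Y J))`. -/
noncomputable def traceNablaJMul (X Y : VF E M) : SF E M :=
  VF.trace (𝒥.calculus_nablaJ_mul_apply X Y)

theorem traceNablaJMul_eq_sum {ι : Type*} [Fintype ι] (X Y : VF E M) (x : M)
    (e : OrthonormalBasis ι ℝ (TangentSpace 𝓘(ℝ, E) x)) : 𝒥.traceNablaJMul X Y x =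
      -∑ k, inner ℝ (𝒥.nablaJ x (X x) (e k)) (𝒥.nablaJ x (Y x) (e k)) := by
  change LinearMap.trace ℝ _ _ = _
  rw [LinearMap.trace_eq_sum_inner _ e, ← Finset.sum_neg_distrib]
  refine Finset.sum_congr rfl fun k _ => ?_
  rw [𝒥.inner_nablaJ, neg_neg]
  rfl

namespace IsNearlyKahler

variable {𝒥} (h : 𝒥.IsNearlyKahler)
include h

theorem inner_r_eq_neg_traceNablaJMul (X Y : VF E M) (x : M) :
    inner ℝ (𝒥.r x (X x)) (Y x) = -𝒥.traceNablaJMul X Y x := by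
  rw [inner_r, 𝒥.traceNablaJMul_eq_sum X Y x (stdOrthonormalBasis ℝ _), neg_neg]
  refine Finset.sum_congr rfl fun k _ => ?_
  rw [h.nablaJ_swap _ (X x), h.nablaJ_swap _ (Y x), inner_neg_neg]

theorem deriv_traceNablaJMul (W X Y : VF E M) :
    VF.deriv W (𝒥.traceNablaJMul X Y) =
      𝒥.traceNablaJMul (𝒥.calculus.canonicalConnection W X) Y
        + 𝒥.traceNablaJMul X (𝒥.calculus.canonicalConnection W Y) := by
  set D := 𝒥.calculus.canonicalConnection W
  have leibniz (Z : VF E M) :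
      D ((𝒥.calculus.nablaJ X * 𝒥.calculus.nablaJ Y : Module.End ℝ (VF E M)) Z) =
        (𝒥.calculus.nablaJ X * 𝒥.calculus.nablaJ Y : Module.End ℝ (VF E M)) (D Z)
          + (𝒥.calculus.nablaJ (D X) * 𝒥.calculus.nablaJ Y
            + 𝒥.calculus.nablaJ X * 𝒥.calculus.nablaJ (D Y) : Module.End ℝ (VF E M)) Z := by
    simp only [Module.End.mul_apply, LinearMap.add_apply]
    rw [h.calculus.canonicalConnection_nablaJ, h.calculus.canonicalConnection_nablaJ, map_add]
    abel
  refine (VF.deriv_trace (𝒥.calculus_nablaJ_mul_apply X Y)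
    (fun Z x => congrArg₂ (· + ·) (𝒥.calculus_nablaJ_mul_apply (D X) Y Z x)
      (𝒥.calculus_nablaJ_mul_apply X (D Y) Z x))
    (𝒥.calculus.deriv_metric_canonicalConnection W) leibniz (b := fun x => _ + _)).trans ?_
  ext x
  exact map_add (LinearMap.trace ℝ (TangentSpace 𝓘(ℝ, E) x)) _ _

theorem contMDiff_r_apply (X : VF E M) : CMDiff ∞ (T% (fun y => 𝒥.r y (X y))) :=
  contMDiff_of_inner fun Y =>
    (𝒥.traceNablaJMul X Y).contMDiff.neg.congr (h.inner_r_eq_neg_traceNablaJMul X Y)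

/-- The tensor `r` on smooth vector fields. -/
noncomputable def rVF : Module.End ℝ (VF E M) where
  toFun X := ⟨fun y => 𝒥.r y (X y), h.contMDiff_r_apply X⟩
  map_add' X Y := by ext y : 1; exact map_add (𝒥.r y) (X y) (Y y)
  map_smul' c X := by ext y : 1; exact map_smul (𝒥.r y) c (X y)

theorem metric_rVF (X Y : VF E M) : VF.metric (h.rVF X) Y = -𝒥.traceNablaJMul X Y := by
  ext x
  exact h.inner_r_eq_neg_traceNablaJMul X Y x

theorem commute_canonicalConnection_rVF (W : VF E M) :
    Commute (𝒥.calculus.canonicalConnection W : Module.End ℝ (VF E M)) h.rVF := by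
  refine LinearMap.ext fun X => VF.ext_metric fun Y => ?_
  have leibniz := 𝒥.calculus.deriv_metric_canonicalConnection W (h.rVF X) Y
  change VF.deriv W (VF.metric _ _) = VF.metric _ _ + VF.metric _ _ at leibniz
  rw [metric_rVF, metric_rVF, map_neg, h.deriv_traceNablaJMul] at leibniz
  change VF.metric (𝒥.calculus.canonicalConnection W (h.rVF X)) Y =
    VF.metric (h.rVF (𝒥.calculus.canonicalConnection W X)) Y
  rw [metric_rVF, ← sub_eq_iff_eq_add.mpr leibniz]
  abel

theorem commute_canonicalConnection_aeval_rVF (W : VF E M) (q : Polynomial ℝ) :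
    Commute (𝒥.calculus.canonicalConnection W : Module.End ℝ (VF E M))
      (Polynomial.aeval h.rVF q) := by
  induction q using Polynomial.induction_on' with
  | add p q hp hq => rw [map_add]; exact hp.add_right hq
  | monomial n a =>
    rw [Polynomial.aeval_monomial]
    exact (Algebra.commute_algebraMap_right a _).mul_right
      ((h.commute_canonicalConnection_rVF W).pow_right n)

theorem pow_rVF_apply (n : ℕ) (X : VF E M) (x : M) :
    (h.rVF ^ n) X x = ((𝒥.r x : Module.End ℝ (TangentSpace 𝓘(ℝ, E) x)) ^ n) (X x) := by
  induction n with
  | zero => rfl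
  | succ n ih =>
    rw [pow_succ', pow_succ', Module.End.mul_apply, Module.End.mul_apply, ← ih]
    rfl

theorem aeval_rVF_apply (q : Polynomial ℝ) (X : VF E M) (x : M) :
    Polynomial.aeval h.rVF q X x =
      Polynomial.aeval (𝒥.r x : Module.End ℝ (TangentSpace 𝓘(ℝ, E) x)) q (X x) := by
  induction q using Polynomial.induction_on' with
  | add p q hp hq => simp only [map_add, LinearMap.add_apply, ← hp, ← hq]; rfl
  | monomial n a =>
    rw [Polynomial.aeval_monomial, Polynomial.aeval_monomial, Module.End.mul_apply,
      Module.End.mul_apply, ← h.pow_rVF_apply]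
    rfl

theorem deriv_trace_aeval_r (q : Polynomial ℝ) (W : VF E M) :
    VF.deriv W (VF.trace (h.aeval_rVF_apply q)) = 0 := by
  rw [VF.deriv_trace (h.aeval_rVF_apply q) (B := 0) (b := 0) (fun _ _ => rfl)
    (𝒥.calculus.deriv_metric_canonicalConnection W) fun X => ?_]
  · ext x
    exact map_zero (LinearMap.trace ℝ (TangentSpace 𝓘(ℝ, E) x))
  · rw [LinearMap.zero_apply, add_zero]
    exact congr($(h.commute_canonicalConnection_aeval_rVF W q) X)

theorem isLocallyConstant_trace_aeval_r (q : Polynomial ℝ) : IsLocallyConstant fun x : M =>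
    LinearMap.trace ℝ _
      (Polynomial.aeval (𝒥.r x : Module.End ℝ (TangentSpace 𝓘(ℝ, E) x)) q) := by
  let t := VF.trace (h.aeval_rVF_apply q)
  refine isLocallyConstant_of_mvfderiv_eq_zero (E := E) (SF.mdiffAt t) fun x => ?_
  ext w
  obtain ⟨W, rfl⟩ := exists_vectorField_apply_eq w
  exact congrArg (fun f : SF E M => f x) (h.deriv_trace_aeval_r q W)

end IsNearlyKahler
end AlmostHermitian
end NearlyKahler

/-! ### Eigenvalues of `r` -/

namespace NearlyKahler

theorem trace_aeval_eq_sum_eigenvalues {V : Type*} [NormedAddCommGroup V] [InnerProductSpace ℝ V]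
    [FiniteDimensional ℝ V] {A : Module.End ℝ V} (hA : LinearMap.IsSymmetric A)
    (q : Polynomial ℝ) :
    LinearMap.trace ℝ V (Polynomial.aeval A q) = ∑ i, q.eval (hA.eigenvalues rfl i) := by
  rw [LinearMap.trace_eq_sum_inner _ (hA.eigenvectorBasis rfl)]
  refine Finset.sum_congr rfl fun i _ => ?_
  rw [Module.End.aeval_apply_of_hasEigenvector (hA.hasEigenvector_eigenvectorBasis rfl i),
    inner_smul_right, real_inner_self_eq_norm_sq, OrthonormalBasis.norm_eq_one]
  simp

theorem hasEigenvalue_of_trace_aeval_eq {V V' : Type*} [NormedAddCommGroup V]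
    [InnerProductSpace ℝ V] [FiniteDimensional ℝ V] [NormedAddCommGroup V']
    [InnerProductSpace ℝ V'] [FiniteDimensional ℝ V'] {S : Module.End ℝ V} {T : Module.End ℝ V'}
    (hS : LinearMap.IsSymmetric S) (hT : LinearMap.IsSymmetric T)
    (h : ∀ q : Polynomial ℝ, LinearMap.trace ℝ V (Polynomial.aeval S q) =
      LinearMap.trace ℝ V' (Polynomial.aeval T q)) {c : ℝ} (hc : T.HasEigenvalue c) :
    S.HasEigenvalue c := by
  -- `q ^ 2` is nonnegative, so its trace on `T` vanishes only if every eigenvalue of `T` is a root.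
  let q : Polynomial ℝ := ∏ i, (Polynomial.X - Polynomial.C (hS.eigenvalues rfl i))
  have hq (t : ℝ) : q.eval t = ∏ i, (t - hS.eigenvalues rfl i) := by
    simp [q, Polynomial.eval_prod]
  have trace_sq : LinearMap.trace ℝ V (Polynomial.aeval S (q ^ 2)) = 0 := by
    rw [trace_aeval_eq_sum_eigenvalues hS]
    refine Finset.sum_eq_zero fun i _ => ?_
    rw [Polynomial.eval_pow, hq, Finset.prod_eq_zero (Finset.mem_univ i) (sub_self _)]
    simp
  rw [h, trace_aeval_eq_sum_eigenvalues hT, Finset.sum_eq_zero_iff_of_nonneg fun i _ => by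
    rw [Polynomial.eval_pow]; positivity] at trace_sq
  obtain ⟨j, rfl⟩ := hT.exists_eigenvalues_eq rfl hc
  have eval_sq := trace_sq j (Finset.mem_univ j)
  rw [Polynomial.eval_pow, sq_eq_zero_iff, hq, Finset.prod_eq_zero_iff] at eval_sq
  obtain ⟨i, -, hi⟩ := eval_sq
  rw [RCLike.ofReal_real_eq_id, id, sub_eq_zero.mp hi]
  exact hS.hasEigenvalue_eigenvalues rfl i

theorem AlmostHermitian.IsNearlyKahler.eigenspace_ne_bot {E : Type*} [NormedAddCommGroup E]
    [NormedSpace ℝ E] [FiniteDimensional ℝ E] {M : Type*} [TopologicalSpace M] [T2Space M]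
    [PreconnectedSpace M] [ChartedSpace E M] [IsManifold 𝓘(ℝ, E) ∞ M]
    [RiemannianBundle (fun x : M => TangentSpace 𝓘(ℝ, E) x)]
    [IsContMDiffRiemannianBundle 𝓘(ℝ, E) ∞ E (fun x : M => TangentSpace 𝓘(ℝ, E) x)]
    {𝒥 : AlmostHermitian 𝓘(ℝ, E) M} (h : 𝒥.IsNearlyKahler) (x : M) {y : M} {c : ℝ}
    (hc : 𝒥.eigenspace y c ≠ ⊥) : 𝒥.eigenspace x c ≠ ⊥ :=
  hasEigenvalue_of_trace_aeval_eq (𝒥.isSymmetric_r x) (𝒥.isSymmetric_r y)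
    (fun q => (h.isLocallyConstant_trace_aeval_r q).apply_eq_of_preconnectedSpace x y) hc

end NearlyKahler

theorem lemma2p1 {E : Type*} [NormedAddCommGroup E] [NormedSpace ℝ E] [FiniteDimensional ℝ E]
    {M : Type*} [TopologicalSpace M] [T2Space M] [SecondCountableTopology M] [ConnectedSpace M]
    [ChartedSpace E M] [IsManifold 𝓘(ℝ, E) ∞ M]
    [RiemannianBundle (fun x : M => TangentSpace 𝓘(ℝ, E) x)]
    [IsContMDiffRiemannianBundle 𝓘(ℝ, E) ∞ E (fun x : M => TangentSpace 𝓘(ℝ, E) x)]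
    (𝒥 : NearlyKahler.AlmostHermitian 𝓘(ℝ, E) M)
    (hNK : 𝒥.IsNearlyKahler) (hstrict : 𝒥.IsStrict) :
    (∀ (x : M) (u v : TangentSpace 𝓘(ℝ, E) x),
      inner ℝ (𝒥.r x u) v = NearlyKahler.ricci 𝓘(ℝ, E) x u v - 𝒥.starRicci x u v) ∧
    ∃ (p : ℕ) (lam : Fin p → ℝ),
      Function.Injective lam ∧ (∀ i, 0 < lam i) ∧
      (∀ (x : M) (i : Fin p), 𝒥.eigenspace x (lam i) ≠ ⊥) ∧
      (∀ x : M, DirectSum.IsInternal (fun i => 𝒥.eigenspace x (lam i))) ∧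
      (∀ (x : M) (i j : Fin p), i ≠ j →
        ∀ u ∈ 𝒥.eigenspace x (lam i), ∀ v ∈ 𝒥.eigenspace x (lam j),
          NearlyKahler.ricci 𝓘(ℝ, E) x u v = 0) ∧
      (∀ (x : M) (i : Fin p),
        ∀ u ∈ 𝒥.eigenspace x (lam i), ∀ v ∈ 𝒥.eigenspace x (lam i),
          NearlyKahler.ricci 𝓘(ℝ, E) x u v =
            lam i / 4 * inner ℝ u v +
              1 / lam i *
                ∑ s, lam s * inner ℝ (𝒥.rPart x (𝒥.eigenspace x (lam s)) u) v) := by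
  refine ⟨fun x u v => hNK.inner_r_eq_ricci_sub_starRicci u v, ?_⟩
  obtain ⟨x₀⟩ := (inferInstance : Nonempty M)
  obtain ⟨p, lam, hlam, hmem⟩ := 𝒥.exists_eigenvalues x₀
  have hne (x : M) (i : Fin p) : 𝒥.eigenspace x (lam i) ≠ ⊥ :=
    hNK.eigenspace_ne_bot x ((hmem _).mpr ⟨i, rfl⟩)
  have hpos (i) : 0 < lam i := hNK.pos_of_eigenspace_ne_bot hstrict (hne x₀ i)
  have hint (x : M) : DirectSum.IsInternal (fun i => 𝒥.eigenspace x (lam i)) :=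
    NearlyKahler.AlmostHermitian.isInternal_eigenspace hlam fun c hc =>
      (hmem c).mp (hNK.eigenspace_ne_bot x₀ hc)
  exact ⟨p, lam, hlam, hpos, hne, hint,
    fun x i j hij u hu v hv => hNK.ricci_eq_zero_of_mem_eigenspace (hlam.ne hij) hu hv,
    fun x i u hu v hv => hNK.ricci_eq_of_mem_eigenspace hlam (hint x) (hpos i).ne' hu hv⟩
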